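/- \textbf{Setting.} Let $a,b\in\mathbb C\setminus\{0\}$, put $\psi=-ia^2b$, and for $\lambda\in\mathbb C^*$ let $$D(\lambda)=\begin{pmatrix}0&-\lambda\bar b&\lambda^{-1}a\\ \lambda^{-1}b&0&-\lambda\bar a\\ -\lambda\bar a&\lambda^{-1}a&0\end{pmatrix}.$$ Let $\sigma(g)=P(g^t)^{-1}P^{-1}$ on $SL(3,\mathbb C)$ with $P=\begin{pmatrix}0&\alpha&0\\ \alpha^2&0&0\\0&0&1\end{pmatrix}$, $\alpha=e^{2\pi i/3}$. A loop $g$ on $|\lambda|=1$ is twisted if $\sigma(g(\lambda))=g(e^{\pi i/3}\lambda)$. Denote by $\Lambda SU(3)_\sigma$ the continuous twisted loops in $SU(3)$, and by $\Lambda^+SL(3,\mathbb C)_\sigma$ the continuous twisted loops in $SL(3,\mathbb C)$ that extend continuously to $|\lambda|\le1$ and holomorphically to $|\lambda|<1$, with values in $SL(3,\mathbb C)$. An extended frame generated by $D(\lambda)\,dz$ is a map $\mathbb F(z,\lambda)$, $z\in\mathbb C$, $|\lambda|=1$, such that for every $z$ there is an Iwasawa decomposition $\exp(zD(\lambda))=\mathbb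 F(z,\lambda)\,V_+(z,\lambda)$ with $\mathbb F(z,\cdot)\in\Lambda SU(3)_\sigma$, $V_+(z,\cdot)\in\Lambda^+SL(3,\mathbb C)_\sigma$. A family $f_\lambda:\mathbb C\to\mathbb CP^2$ is generated by $D(\lambda)\,dz$ if $f_\lambda(z)=[\mathbb F(z,\lambda)e_3]$ for such a frame. \textbf{Theorem.} Let the family $f_\lambda$, $|\lambda|=1$, be generated by $D(\lambda)\,dz$ with extended frame $\mathbb F$, and put $F(z,\lambda)=\mathbb F(z,\lambda)e_3$. There is a smooth $u:\mathbb R\to\mathbb R$ with $$\tfrac14u''+e^u-|\psi|^2e^{-2u}=0,\qquad e^{u(0)}=|a|^2,\qquad u'(0)=0,$$ such that for all $|\lambda|=1$, writing $z=x+iy$ and $u=u(y)$: (i) $F(\cdot,\lambda):\mathbb C\to S^5\subset\mathbb C^3$ is a smooth horizontal lift of $f_\lambda$, that is $|F|=1$, $[F]=f_\lambda$ and $F_x\cdot\bar F=F_y\cdot\bar F=0$; (ii) $f_\lambda$ is a conformal minimal Lagrangian immersion with metric $2e^{u}\,dz\,d\bar z$, that is $|F_x|^2=|F_y|^2=2e^u$,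 $F_x\cdot\overline{F_y}=0$ and $F_{xx}+F_{yy}=-4e^uF$; it is translationally equivariant, with $F(z+t,\lambda)=e^{tD(\lambda)}F(z,\lambda)$ for $t\in\mathbb R$; (iii) if $\lambda^{-3}\psi\notin\mathbb R$, then for every orthonormal basis $l_1,l_2,l_3$ of $\mathbb C^3$ with $D(\lambda)l_j=\mu_jl_j$ and all $z\in\mathbb C$, $$F(z,\lambda)=\sum_{j=1}^3e^{g_j(z,\lambda)}\,\langle l_j,Q^{-1}e_3\rangle\,l_j,\qquad g_j=z\mu_j-\beta_1\mu_j-\beta_2\Big(\mu_j^2-\tfrac13\sum_{k=1}^3\mu_k^2\Big),$$ where $\langle v,w\rangle=\bar v^tw$ and, with $\delta=\lambda^3\bar\psi-\lambda^{-3}\psi$ and $\check c=\delta-e^uu'$, $$\beta_1(y,\lambda)=\int_0^y\frac{2i\lambda^3\bar\psi-iu'e^u}{\check c}\,ds,\qquad \beta_2(y,\lambda)=\int_0^y\frac{2e^u}{\check c}\,ds,$$ and $Q(y,\lambda)=\mathrm{diag}(ia^{-1}e^{u/2},-iae^{-u/2},1)\;\check c^{-2/3}\delta^{-1/3}\begin{pmatrix}\check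 p&\check q&\check v_1\\ \check s&\check t&\check v_2\\0&0&\check c\end{pmatrix}$ with principal powers and $$\begin{aligned}\check p&=-|a|^2\tfrac{u'}2+\lambda^3\bar\psi|a|^2e^{-u}-\lambda^{-3}\psi,&\check q&=\tfrac{\lambda^{-2}a}{\bar a}\big[\tfrac{u'}2|a|^2-\lambda^3\bar\psi e^{-u}(|a|^2-e^u)\big],\\ \check s&=\tfrac{\lambda^2}{a^2}\big[|a|^2\tfrac{u'}2e^u+\lambda^{-3}\psi(|a|^2-e^u)\big],&\check t&=\tfrac1{|a|^2}\big(-|a|^2\tfrac{u'}2e^u+\lambda^3\bar\psi e^u-\lambda^{-3}\psi|a|^2\big),\\ \check v_1&=-2i\lambda^{-1}a(|a|^2-e^u),&\check v_2&=-2i\lambda a^{-1}e^u(|a|^2-e^u).\end{aligned}$$ -/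

import Mathlib

noncomputable section

namespace MinLag

open Complex

/-- Hermitian `ℂ³`; its unit sphere is `S⁵`. -/
abbrev C3 : Type := EuclideanSpace ℂ (Fin 3)

/-- Complex `3 × 3` matrices. -/
abbrev M3 : Type := Matrix (Fin 3) (Fin 3) ℂ

/-- The complex projective plane. -/
abbrev CP2 : Type := Projectivization ℂ C3

/-- The third standard basis vector `e₃`. -/
def e3 : C3 := EuclideanSpace.single 2 1

/-! ### Twisted loops and the Iwasawa decomposition -/

/-- The matrix `P` that defines the automorphism `σ(g) = P (gᵗ)⁻¹ P⁻¹` of order six of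
`SL(3, ℂ)`, with `α = exp (2πi/3)`. -/
def twistP : M3 :=
  !![0, exp (2 * Real.pi * I / 3), 0; exp (2 * Real.pi * I / 3) ^ 2, 0, 0; 0, 0, 1]

/-- The automorphism `σ(g) = P (gᵗ)⁻¹ P⁻¹` of order six. -/
def sigma (g : M3) : M3 := twistP * (g.transpose)⁻¹ * twistP⁻¹

/-- The twisting condition `σ(g(ζ)) = g(ε ζ)` on the unit circle, with `ε = exp (πi/3)`. -/
def IsTwisted (g : ℂ → M3) : Prop :=
  ∀ ζ : ℂ, ‖ζ‖ = 1 → sigma (g ζ) = g (exp (Real.pi * I / 3) * ζ)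

/-- `h` restricts to an element of the twisted loop group `Λ SU(3)_σ`. -/
structure IsUnitaryLoop (h : ℂ → M3) : Prop where
  continuousOn : ContinuousOn h (Metric.sphere 0 1)
  mem_SU : ∀ ζ : ℂ, ‖ζ‖ = 1 → h ζ ∈ Matrix.specialUnitaryGroup (Fin 3) ℂ
  twisted : IsTwisted h

/-- `v` restricts to an element of `Λ⁺ SL(3, ℂ)_σ`: a twisted loop that extends continuously to
the closed unit disc, with values in `SL(3, ℂ)` and holomorphically in the open disc. -/
structure IsPlusLoop (v : ℂ → M3) : Prop where
  continuousOn : ContinuousOn v (Metric.closedBall 0 1)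
  holomorphic : ∀ i j, DifferentiableOn ℂ (fun ζ => v ζ i j) (Metric.ball 0 1)
  det_eq_one : ∀ ζ : ℂ, ‖ζ‖ ≤ 1 → (v ζ).det = 1
  twisted : IsTwisted v

/-- `g = h v` is an Iwasawa decomposition of the loop `g`. -/
structure IsIwasawa (g h v : ℂ → M3) : Prop where
  unitary : IsUnitaryLoop h
  plus : IsPlusLoop v
  mul_eq : ∀ ζ : ℂ, ‖ζ‖ = 1 → g ζ = h ζ * v ζ

/-! ### Potentials and the immersions they generate -/

/-- The degree one constant potential with vanishing diagonal,
`D(ζ) = ζ⁻¹ D₋₁ + ζ D₁`, with coefficients `a` and `b`. -/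
def potential (a b ζ : ℂ) : M3 :=
  !![0, -ζ * star b, ζ⁻¹ * a;
     ζ⁻¹ * b, 0, -ζ * star a;
     -ζ * star a, ζ⁻¹ * a, 0]

/-- `𝔽(z, ζ)` is an extended frame generated by the potential `D(ζ) dz`: for every `z` the loop
`𝔽(z, ·)` is the unitary factor in an Iwasawa decomposition of `exp (z D(·))`, the solution of
`dC = C D dz`, `C(0) = I`. -/
def IsExtendedFrame (D : ℂ → M3) (𝔽 : ℂ → ℂ → M3) : Prop :=
  ∀ z : ℂ, ∃ v : ℂ → M3, IsIwasawa (fun ζ => NormedSpace.exp (z • D ζ)) (𝔽 z) v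

/-- The third column `F(z, ζ) = 𝔽(z, ζ) e₃` of a frame. -/
def thirdColumn (𝔽 : ℂ → ℂ → M3) (ζ z : ℂ) : C3 := Matrix.toEuclideanLin (𝔽 z ζ) e3

/-- `F` is a lift of the map `f` into `ℂP²` to `ℂ³ \ {0}`. -/
def IsLift (f : ℂ → CP2) (F : ℂ → C3) : Prop :=
  ∀ z : ℂ, ∃ hz : F z ≠ 0, f z = Projectivization.mk ℂ (F z) hz

/-- The family `f_ζ = f ζ`, `|ζ| = 1`, is generated by the potential `D(ζ) dz`, with extended
frame `𝔽`. -/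
structure IsGeneratedBy (D : ℂ → M3) (𝔽 : ℂ → ℂ → M3) (f : ℂ → ℂ → CP2) : Prop where
  frame : IsExtendedFrame D 𝔽
  proj : ∀ ζ : ℂ, ‖ζ‖ = 1 → IsLift (f ζ) (thirdColumn 𝔽 ζ)

/-! ### Horizontal lifts, equivariance and minimal Lagrangian immersions -/

/-- `F` is a (smooth) horizontal lift to `S⁵` of the map `f` into `ℂP²`. -/
structure IsHorizontalLift (f : ℂ → CP2) (F : ℂ → C3) : Prop where
  lift : IsLift f F
  smooth : ContDiff ℝ (⊤ : ℕ∞) F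
  norm_eq_one : ∀ z, ‖F z‖ = 1
  horizontal : ∀ z v : ℂ, inner ℂ (F z) (fderiv ℝ F z v) = 0

/-- For a horizontal lift `F` to `S⁵` of a map into `ℂP²`: that map is a conformal minimal
Lagrangian immersion with induced metric `2 e^u dz dz̄`. The induced metric is
`|dF|²` because `F` is horizontal, the vanishing Hermitian product of `F_x` and `F_y` is
conformality (real part) and the Lagrangian condition (imaginary part), and the last equation says
that the horizontal immersion `F` into `S⁵`, equivalently its projection, has mean curvature zero:
the Laplacian of the metric `2 e^u dz dz̄` maps `F` to `-2 F`. -/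
structure IsConformalMinimalLagrangianLift (F : ℂ → C3) (u : ℂ → ℝ) : Prop where
  norm_sq_dx : ∀ z, ‖fderiv ℝ F z 1‖ ^ 2 = 2 * Real.exp (u z)
  norm_sq_dy : ∀ z, ‖fderiv ℝ F z I‖ ^ 2 = 2 * Real.exp (u z)
  inner_dx_dy : ∀ z, inner ℂ (fderiv ℝ F z 1) (fderiv ℝ F z I) = 0
  minimal : ∀ z, Laplacian.laplacian F z = (-4 * Real.exp (u z)) • F z

/-! ### The explicit Iwasawa decomposition -/

/-- The Hopf coefficient `ψ = -i a² b`. -/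
def psi (a b : ℂ) : ℂ := -I * a ^ 2 * b

/-- `u` is the solution of `u''/4 + e^u - |ψ|² e^{-2u} = 0` with `e^{u(0)} = |a|²`,
`u'(0) = 0`. -/
structure IsMetricExponent (a b : ℂ) (u : ℝ → ℝ) : Prop where
  smooth : ContDiff ℝ (⊤ : ℕ∞) u
  gauss : ∀ y, deriv (deriv u) y / 4 + Real.exp (u y)
    - ‖psi a b‖ ^ 2 * Real.exp (-2 * u y) = 0
  exp_zero : Real.exp (u 0) = ‖a‖ ^ 2
  deriv_zero : deriv u 0 = 0

/-- `ζ³ ψ̄ - ζ⁻³ ψ`. -/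
def delta (a b ζ : ℂ) : ℂ := ζ ^ 3 * star (psi a b) - ζ⁻¹ ^ 3 * psi a b

/-- `č = ζ³ ψ̄ - ζ⁻³ ψ - e^u u'`. -/
def cCheck (a b : ℂ) (u : ℝ → ℝ) (y : ℝ) (ζ : ℂ) : ℂ :=
  delta a b ζ - (Real.exp (u y) * deriv u y : ℝ)

/-- `Q₀ = diag (i a⁻¹ e^{u/2}, -i a e^{-u/2}, 1)`. -/
def Q0 (a : ℂ) (u : ℝ → ℝ) (y : ℝ) : M3 :=
  Matrix.diagonal ![I * a⁻¹ * Real.exp (u y / 2), -I * a * Real.exp (-u y / 2), 1]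

/-- The matrix `Q̃` without its scalar factor. -/
def QtildeCore (a b : ℂ) (u : ℝ → ℝ) (y : ℝ) (ζ : ℂ) : M3 :=
  let A : ℂ := (‖a‖ ^ 2 : ℝ)
  let E : ℂ := Real.exp (u y)
  let u' : ℂ := (deriv u y : ℝ)
  let ψ : ℂ := psi a b
  !![-A * (u' / 2) + ζ ^ 3 * star ψ * A * E⁻¹ - ζ⁻¹ ^ 3 * ψ,
     ζ⁻¹ ^ 2 * a / star a * (u' / 2 * A - ζ ^ 3 * star ψ * E⁻¹ * (A - E)),
     -2 * I * ζ⁻¹ * a * (A - E);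
     ζ ^ 2 / a ^ 2 * (A * (u' / 2) * E + ζ⁻¹ ^ 3 * ψ * (A - E)),
     1 / A * (-A * (u' / 2) * E + ζ ^ 3 * star ψ * E - ζ⁻¹ ^ 3 * ψ * A),
     -2 * I * ζ * a⁻¹ * E * (A - E);
     0, 0, cCheck a b u y ζ]

/-- `Q = Q₀ Q̃`. The scalar factor of `Q̃` is `1 / (č^{2/3} (ζ³ ψ̄ - ζ⁻³ ψ)^{1/3})`. For `|ζ| = 1`
with `ζ⁻³ ψ` not real, both bases stay on one line parallel to the real axis, off the branch
cut, so that the principal powers are continuous in `y`, and `Q̃ = I` at `y = 0`. -/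
def Q (a b : ℂ) (u : ℝ → ℝ) (y : ℝ) (ζ : ℂ) : M3 :=
  Q0 a u y * ((cCheck a b u y ζ ^ (2 / 3 : ℂ) * delta a b ζ ^ (1 / 3 : ℂ))⁻¹ •
    QtildeCore a b u y ζ)

/-- `β₁(y, ζ)`. -/
def beta1 (a b : ℂ) (u : ℝ → ℝ) (y : ℝ) (ζ : ℂ) : ℂ :=
  ∫ s in (0 : ℝ)..y,
    (2 * I * ζ ^ 3 * star (psi a b) - I * (deriv u s * Real.exp (u s) : ℝ)) / cCheck a b u s ζ

/-- `β₂(y, ζ)`. -/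
def beta2 (a b : ℂ) (u : ℝ → ℝ) (y : ℝ) (ζ : ℂ) : ℂ :=
  ∫ s in (0 : ℝ)..y, 2 * Real.exp (u s) / cCheck a b u s ζ

/-- `g_j = z μ_j - β₁ μ_j - β₂ (μ_j² - (μ₁² + μ₂² + μ₃²)/3)` with `y = Im z`. -/
def gExp (a b : ℂ) (u : ℝ → ℝ) (z ζ : ℂ) (μ : Fin 3 → ℂ) (j : Fin 3) : ℂ :=
  z * μ j - beta1 a b u z.im ζ * μ j
    - beta2 a b u z.im ζ * (μ j ^ 2 - 1 / 3 * ∑ k, μ k ^ 2)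

end MinLag

end

/-! The Iwasawa splitting of exp(zD) is written down explicitly. Let T solve T' = ζBT, T(0) = 1,
with B = `laxB` built from u. The equation for u gives N = `laxN` the Lax equation N' = ζ[B, N], and
the initial values of u give N(0) = D, so N = T D T⁻¹ (`IsPlusFlow.lax`). Hence R = exp(zD) T⁻¹
satisfies dR = R(N dx + K dy) with K = iN − ζB, and on |ζ| = 1 this forces R*R = `metricDiag` =
Q₀*Q₀ (`IsPlusFlow.conj_frameR`). In exp(zD) = (R Q₀⁻¹)(Q₀T) the left factor is therefore unitary on
the circle, while Q₀T is entire in ζ, twisted and of determinant one.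

The quotient of the plus factors of two such splittings is unitary on the circle and holomorphic
inside, hence constant, and it is fixed by σ; a matrix of this kind fixes e₃
(`col3_eq_of_isIwasawa`). Thus F = R e₃ for every extended frame. Horizontality, metric and
minimality become statements about the third columns of N, K and N² + K² + K', and equivariance is
exp((z + t)D) = exp(tD) exp(zD).

For the closed formula, Q̃ exp(β₁D) exp(β₂(D² − κ)) with κ = tr(D²)/3 solves the linear equation of
T with the same initial value (`QtildeCore_ode`, `IsPlusFlow.eq_Qtilde`). So F = exp(zD) exp(−β₂(D²
− κ)) exp(−β₁D) Q⁻¹e₃, and each exponential acts on an eigenvector l_j as a scalar. -/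

namespace MinLag

open MeasureTheory Set

/-! ### Global Picard iteration for Lipschitz autonomous equations -/

section GlobalODE

variable {E : Type*} [NormedAddCommGroup E] [NormedSpace ℝ E]

/-- Each integration gains a factor 1/(n + 1); iterating it produces the factorials behind both the
Picard and the Dyson series, for either sign of t. -/
theorem norm_integral_le_of_norm_le_pow {h : ℝ → E} {c t : ℝ} (n : ℕ)
    (hb : ∀ s, |s| ≤ |t| → ‖h s‖ ≤ c * |s| ^ n) :
    ‖∫ s in (0 : ℝ)..t, h s‖ ≤ c * (|t| ^ (n + 1) / (n + 1)) := by
  rw [intervalIntegral.norm_integral_eq_norm_integral_uIoc]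
  have hi : ∫ s in uIoc 0 t, c * |s| ^ n = c * (|t| ^ (n + 1) / (n + 1)) := by
    rw [integral_const_mul]
    congr 1
    simpa using integral_pow_abs_sub_uIoc (a := 0) (b := t) n
  rw [← hi]
  refine norm_integral_le_of_norm_le ?_ ?_
  · exact ((by fun_prop : Continuous fun s : ℝ => c * |s| ^ n).intervalIntegrable 0 t).def'
  · refine (ae_restrict_iff' measurableSet_uIoc).2 (Filter.Eventually.of_forall fun s hs => hb s ?_)
    rcases le_total 0 t with h0 | h0
    · rw [uIoc_of_le h0] at hs
      rw [abs_of_pos hs.1, abs_of_nonneg h0]; exact hs.2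
    · rw [uIoc_of_ge h0] at hs
      rw [abs_of_nonpos hs.2, abs_of_nonpos h0]; linarith [hs.1]

/-- Picard iterates of an autonomous equation. -/
noncomputable def picardIterate (f : E → E) (x₀ : E) : ℕ → ℝ → E
  | 0 => fun _ => x₀
  | n + 1 => fun t => x₀ + ∫ s in (0 : ℝ)..t, f (picardIterate f x₀ n s)

theorem picardIterate_zero_right (f : E → E) (x₀ : E) (n : ℕ) : picardIterate f x₀ n 0 = x₀ := by
  cases n <;> simp [picardIterate]

variable [CompleteSpace E]

theorem hasDerivAt_integral_of_continuous {h : ℝ → E} (hc : Continuous h) (t : ℝ) :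
    HasDerivAt (fun t => ∫ s in (0 : ℝ)..t, h s) (h t) t :=
  intervalIntegral.integral_hasDerivAt_right (hc.intervalIntegrable _ _)
    (hc.stronglyMeasurableAtFilter _ _) hc.continuousAt

theorem continuous_picardIterate {f : E → E} (hf : Continuous f) (x₀ : E) (n : ℕ) :
    Continuous (picardIterate f x₀ n) := by
  induction n with
  | zero => exact continuous_const
  | succ n ih =>
    exact continuous_const.add (continuous_iff_continuousAt.2 fun t =>
      (hasDerivAt_integral_of_continuous (hf.comp ih) t).continuousAt)

theorem hasDerivAt_picardIterate_succ {f : E → E} (hf : Continuous f) (x₀ : E) (n : ℕ) (t : ℝ) :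
    HasDerivAt (picardIterate f x₀ (n + 1)) (f (picardIterate f x₀ n t)) t :=
  (hasDerivAt_integral_of_continuous (hf.comp (continuous_picardIterate hf x₀ n)) t).const_add x₀

theorem norm_picardIterate_succ_sub_le {f : E → E} {K : NNReal} (hf : LipschitzWith K f) (x₀ : E)
    (n : ℕ) (t : ℝ) :
    ‖picardIterate f x₀ (n + 1) t - picardIterate f x₀ n t‖ ≤
      ‖f x₀‖ * K ^ n / (n + 1).factorial * |t| ^ (n + 1) := by
  induction n generalizing t with
  | zero =>
    have := norm_integral_le_of_norm_le_pow (h := fun _ => f x₀) (c := ‖f x₀‖) (t := t) 0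
      (by simp)
    simpa [picardIterate] using this
  | succ n ih =>
    have hc : ∀ m, Continuous fun s => f (picardIterate f x₀ m s) := fun m =>
      hf.continuous.comp (continuous_picardIterate hf.continuous x₀ m)
    have e : picardIterate f x₀ (n + 1 + 1) t - picardIterate f x₀ (n + 1) t =
        ∫ s in (0 : ℝ)..t,
          (f (picardIterate f x₀ (n + 1) s) - f (picardIterate f x₀ n s)) := by
      rw [intervalIntegral.integral_sub ((hc (n + 1)).intervalIntegrable _ _)
        ((hc n).intervalIntegrable _ _)]
      simp [picardIterate]
    rw [e]
    refine (norm_integral_le_of_norm_le_pow (c := K * (‖f x₀‖ * K ^ n / (n + 1).factorial)) (n + 1)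
      fun s _ => ?_).trans (le_of_eq ?_)
    · rw [mul_assoc]
      exact (hf.norm_sub_le _ _).trans (mul_le_mul_of_nonneg_left (ih s) K.2)
    · rw [Nat.factorial_succ (n + 1)]
      push_cast
      field_simp
      ring

/-- An autonomous differential equation with a globally Lipschitz right-hand side has global
solutions. -/
theorem exists_global_solution {f : E → E} {K : NNReal} (hf : LipschitzWith K f) (x₀ : E) :
    ∃ x : ℝ → E, x 0 = x₀ ∧ ∀ t, HasDerivAt x (f (x t)) t := by
  let X := picardIterate f x₀
  let d : ℕ → ℝ → E := fun n t => X (n + 1) t - X n t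
  have hd : ∀ n t, ‖d n t‖ ≤ ‖f x₀‖ * K ^ n / (n + 1).factorial * |t| ^ (n + 1) :=
    norm_picardIterate_succ_sub_le hf x₀
  have hs : ∀ R : ℝ, Summable fun n : ℕ => ‖f x₀‖ * K ^ n / (n + 1).factorial * R ^ (n + 1) := by
    intro R
    have h := (Real.summable_pow_div_factorial (K * R)).mul_left (‖f x₀‖ * |R|)
    refine Summable.of_norm_bounded (h.norm) fun n => ?_
    simp only [norm_mul, norm_div, norm_pow, Real.norm_eq_abs, abs_abs, NNReal.abs_eq,
      Nat.abs_cast, abs_norm]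
    have h1 : ((n.factorial : ℕ) : ℝ) ≤ ((n + 1).factorial : ℕ) := by
      exact_mod_cast Nat.factorial_le (Nat.le_succ n)
    have h2 : (0 : ℝ) < (n.factorial : ℕ) := by exact_mod_cast n.factorial_pos
    calc ‖f x₀‖ * K ^ n / (n + 1).factorial * |R| ^ (n + 1)
        ≤ ‖f x₀‖ * K ^ n / n.factorial * |R| ^ (n + 1) := by gcongr
      _ = _ := by rw [mul_pow]; ring
  have hsum : ∀ t, Summable fun n => d n t := fun t =>
    Summable.of_norm_bounded (hs |t|) fun n => hd n t
  let x : ℝ → E := fun t => x₀ + ∑' n, d n t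
  have hX : ∀ t, Filter.Tendsto (fun n => X n t) Filter.atTop (nhds (x t)) := by
    intro t
    have h := (hsum t).hasSum.tendsto_sum_nat.const_add x₀
    refine h.congr fun n => ?_
    rw [Finset.sum_range_sub (fun n => X n t) n]
    simp [X, picardIterate]
  refine ⟨x, ?_, fun t => ?_⟩
  · simp [x, d, X, picardIterate_zero_right]
  -- Term-by-term derivatives of the telescoping series. The first is separate because the zeroth
  -- iterate is constant.
  · let d' : ℕ → ℝ → E := fun n t =>
      match n with
      | 0 => f x₀
      | n + 1 => f (X (n + 1) t) - f (X n t)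
    have hder : ∀ n t, HasDerivAt (d n) (d' n t) t := by
      intro n t
      cases n with
      | zero =>
        have := hasDerivAt_picardIterate_succ hf.continuous x₀ 0 t
        exact this.sub_const x₀
      | succ n =>
        exact (hasDerivAt_picardIterate_succ hf.continuous x₀ (n + 1) t).sub
          (hasDerivAt_picardIterate_succ hf.continuous x₀ n t)
    let R := |t| + 1
    let b : ℕ → ℝ := fun n =>
      match n with
      | 0 => ‖f x₀‖
      | n + 1 => K * (‖f x₀‖ * K ^ n / (n + 1).factorial * R ^ (n + 1))
    have hb : Summable b := (summable_nat_add_iff 1).1 ((hs R).mul_left (K : ℝ))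
    have hbd : ∀ n, ∀ s ∈ Metric.ball (0 : ℝ) R, ‖d' n s‖ ≤ b n := by
      intro n s hs'
      rw [mem_ball_zero_iff, Real.norm_eq_abs] at hs'
      cases n with
      | zero => exact le_rfl
      | succ n =>
        refine (hf.norm_sub_le _ _).trans (mul_le_mul_of_nonneg_left ((hd n s).trans ?_) K.2)
        gcongr
    have ht : t ∈ Metric.ball (0 : ℝ) R := by
      rw [mem_ball_zero_iff, Real.norm_eq_abs]; simp [R]
    have key := (hasDerivAt_tsum_of_isPreconnected hb Metric.isOpen_ball
      (convex_ball (0 : ℝ) R).isPreconnected (fun n y _ => hder n y) hbd ht (hsum t)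
      ht).const_add x₀
    -- The first n + 1 differentiated terms telescope to f(Xₙ(t)), which tends to f(x(t)).
    have hval : ∑' n, d' n t = f (x t) := by
      have h1 : HasSum (fun n => d' n t) (∑' n, d' n t) :=
        (Summable.of_norm_bounded hb fun n => hbd n t ht).hasSum
      refine tendsto_nhds_unique ((Filter.tendsto_add_atTop_iff_nat 1).2 h1.tendsto_sum_nat) ?_
      refine ((hf.continuous.tendsto _).comp (hX t)).congr fun n => ?_
      rw [Finset.sum_range_succ']
      change f (X n t) = (∑ i ∈ Finset.range n, (f (X (i + 1) t) - f (X i t))) + f x₀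
      rw [Finset.sum_range_sub (fun n => f (X n t)) n]
      simp [X, picardIterate]
    rw [hval] at key
    exact key

end GlobalODE

/-! ### Linear equations depending holomorphically on a parameter -/

section Dyson

variable {𝔸 : Type*} [NormedRing 𝔸] [NormedAlgebra ℂ 𝔸]

/-- Iterated integrals of `B`: the coefficients of the Dyson series. -/
noncomputable def dysonTerm (B : ℝ → 𝔸) : ℕ → ℝ → 𝔸
  | 0 => fun _ => 1
  | n + 1 => fun t => ∫ s in (0 : ℝ)..t, B s * dysonTerm B n s

theorem norm_dysonTerm_le {B : ℝ → 𝔸} {M R : ℝ} (hM : 0 ≤ M) (hBM : ∀ s, |s| ≤ R → ‖B s‖ ≤ M)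
    (n : ℕ) (t : ℝ) (ht : |t| ≤ R) :
    ‖dysonTerm B n t‖ ≤ ‖(1 : 𝔸)‖ * M ^ n / n.factorial * |t| ^ n := by
  induction n generalizing t with
  | zero => simp [dysonTerm]
  | succ n ih =>
    refine (norm_integral_le_of_norm_le_pow (c := M * (‖(1 : 𝔸)‖ * M ^ n / n.factorial)) n
      fun s hs => ?_).trans (le_of_eq ?_)
    · rw [mul_assoc]
      exact (norm_mul_le _ _).trans (mul_le_mul (hBM s (hs.trans ht)) (ih s (hs.trans ht))
        (norm_nonneg _) hM)
    · rw [Nat.factorial_succ n]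
      push_cast
      field_simp
      ring

variable [CompleteSpace 𝔸]

theorem continuous_dysonTerm {B : ℝ → 𝔸} (hB : Continuous B) (n : ℕ) :
    Continuous (dysonTerm B n) := by
  induction n with
  | zero => exact continuous_const
  | succ n ih =>
    exact continuous_iff_continuousAt.2 fun t =>
      (hasDerivAt_integral_of_continuous (hB.mul ih) t).continuousAt

theorem hasDerivAt_dysonTerm_succ {B : ℝ → 𝔸} (hB : Continuous B) (n : ℕ) (t : ℝ) :
    HasDerivAt (dysonTerm B (n + 1)) (B t * dysonTerm B n t) t :=
  hasDerivAt_integral_of_continuous (hB.mul (continuous_dysonTerm hB n)) t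

/-- The equation `T' = ζ B T`, `T(0) = 1` has a global solution that is entire in `ζ`. -/
theorem exists_entire_linear_solution {B : ℝ → 𝔸} (hB : Continuous B) :
    ∃ T : ℝ → ℂ → 𝔸, (∀ ζ, T 0 ζ = 1) ∧
      (∀ y ζ, HasDerivAt (fun s => T s ζ) (ζ • (B y * T y ζ)) y) ∧
      ∀ y, Differentiable ℂ (T y) := by
  have hbound : ∀ R : ℝ, ∃ M : ℝ, 0 ≤ M ∧ ∀ s, |s| ≤ R → ‖B s‖ ≤ M := by
    intro R
    obtain ⟨M, hM⟩ := (isCompact_Icc (a := -R) (b := R)).exists_bound_of_continuousOn hB.continuousOn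
    exact ⟨|M|, abs_nonneg _, fun s hs => (hM s (abs_le.1 hs)).trans (le_abs_self M)⟩
  have hsum0 : ∀ R c : ℝ, Summable fun n : ℕ => ‖(1 : 𝔸)‖ * c ^ n / n.factorial * R ^ n := by
    intro R c
    refine ((Real.summable_pow_div_factorial (c * R)).mul_left ‖(1 : 𝔸)‖).congr fun n => ?_
    rw [mul_pow]; ring
  have hle : ∀ (y ρ M : ℝ) (ζ : ℂ), 0 ≤ M → ‖ζ‖ ≤ ρ → (∀ s, |s| ≤ |y| → ‖B s‖ ≤ M) → ∀ n : ℕ,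
      ‖ζ ^ n • dysonTerm B n y‖ ≤ ‖(1 : 𝔸)‖ * (ρ * M) ^ n / n.factorial * |y| ^ n := by
    intro y ρ M ζ hM hζ hBM n
    rw [norm_smul, norm_pow]
    calc ‖ζ‖ ^ n * ‖dysonTerm B n y‖
        ≤ ρ ^ n * (‖(1 : 𝔸)‖ * M ^ n / n.factorial * |y| ^ n) := by
          gcongr
          · exact pow_nonneg ((norm_nonneg _).trans hζ) n
          · exact norm_dysonTerm_le hM hBM n y le_rfl
      _ = _ := by rw [mul_pow]; ring
  have hsum : ∀ (y : ℝ) (ζ : ℂ), Summable fun n : ℕ => ζ ^ n • dysonTerm B n y := by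
    intro y ζ
    obtain ⟨M, hM, hBM⟩ := hbound |y|
    exact Summable.of_norm_bounded (hsum0 |y| (‖ζ‖ * M)) (hle y ‖ζ‖ M ζ hM le_rfl hBM)
  -- With the constant term split off, the derivative of term n + 1 is ζB times term n, so the
  -- differentiated series is ζB times the original one.
  have hT : ∀ (y : ℝ) (ζ : ℂ), ∑' n : ℕ, ζ ^ n • dysonTerm B n y =
      1 + ∑' n : ℕ, ζ ^ (n + 1) • dysonTerm B (n + 1) y := by
    intro y ζ
    rw [(hsum y ζ).tsum_eq_zero_add]
    simp [dysonTerm]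
  refine ⟨fun y ζ => ∑' n : ℕ, ζ ^ n • dysonTerm B n y, fun ζ => ?_, fun y ζ => ?_, fun y => ?_⟩
  · simp only [hT]
    simp [dysonTerm]
  · simp only [hT]
    let R := |y| + 1
    have hy : y ∈ Metric.ball (0 : ℝ) R := by
      rw [mem_ball_zero_iff, Real.norm_eq_abs]; simp [R]
    obtain ⟨M, hM, hBM⟩ := hbound R
    have hder : ∀ (n : ℕ), ∀ s ∈ Metric.ball (0 : ℝ) R,
        HasDerivAt (fun s => ζ ^ (n + 1) • dysonTerm B (n + 1) s)
          (ζ • (B s * (ζ ^ n • dysonTerm B n s))) s := by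
      intro n s _
      have h := (hasDerivAt_dysonTerm_succ hB n s).const_smul (ζ ^ (n + 1))
      have e : ζ • (B s * (ζ ^ n • dysonTerm B n s)) =
          ζ ^ (n + 1) • (B s * dysonTerm B n s) := by
        rw [mul_smul_comm, smul_smul, pow_succ']
      rw [e]
      exact h
    have hbd : ∀ (n : ℕ), ∀ s ∈ Metric.ball (0 : ℝ) R,
        ‖ζ • (B s * (ζ ^ n • dysonTerm B n s))‖ ≤
          ‖ζ‖ * (M * (‖(1 : 𝔸)‖ * (‖ζ‖ * M) ^ n / n.factorial * R ^ n)) := by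
      intro n s hs
      rw [mem_ball_zero_iff, Real.norm_eq_abs] at hs
      rw [norm_smul]
      gcongr
      refine (norm_mul_le _ _).trans ?_
      gcongr
      · exact hBM s hs.le
      · refine (hle s ‖ζ‖ M ζ hM le_rfl (fun r hr => hBM r (hr.trans hs.le)) n).trans ?_
        gcongr
    have hs1 := (summable_nat_add_iff 1).2 (hsum y ζ)
    have key := (hasDerivAt_tsum_of_isPreconnected
      (((hsum0 R (‖ζ‖ * M)).mul_left M).mul_left ‖ζ‖) Metric.isOpen_ball
      (convex_ball (0 : ℝ) R).isPreconnected hder hbd hy hs1 hy).const_add 1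
    rw [← hT]
    rw [((hsum y ζ).mul_left (B y)).tsum_const_smul, (hsum y ζ).tsum_mul_left] at key
    exact key
  · rw [← differentiableOn_univ]
    intro ζ _
    obtain ⟨M, hM, hBM⟩ := hbound |y|
    have h := Complex.differentiableOn_tsum_of_summable_norm
      (F := fun (n : ℕ) (ζ : ℂ) => ζ ^ n • dysonTerm B n y) (hsum0 |y| ((‖ζ‖ + 1) * M))
      (fun n => by fun_prop) (Metric.isOpen_ball (x := (0 : ℂ)) (ε := ‖ζ‖ + 1))
      (fun n w hw => hle y (‖ζ‖ + 1) M w hM (mem_ball_zero_iff.1 hw).le hBM n)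
    exact (h.differentiableAt (Metric.isOpen_ball.mem_nhds (by simp))).differentiableWithinAt

end Dyson

end MinLag

namespace MinLag

open MeasureTheory Set

/-! ### Existence of u and its first integral -/

section MetricExponent

/-- The energy of the equation `u''/4 + e^u - c e^{-2u} = 0`. -/
noncomputable def energy (c : ℝ) (x : ℝ × ℝ) : ℝ :=
  x.2 ^ 2 / 8 + Real.exp x.1 + c / 2 * Real.exp (-2 * x.1)

/-- The vector field of the equation `u''/4 + e^u - c e^{-2u} = 0`. -/
noncomputable def energyField (c : ℝ) (x : ℝ × ℝ) : ℝ × ℝ :=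
  (x.2, -4 * Real.exp x.1 + 4 * c * Real.exp (-2 * x.1))

theorem contDiff_energyField (c : ℝ) : ContDiff ℝ (⊤ : ℕ∞) (energyField c) := by
  unfold energyField
  fun_prop

/-- All three summands are nonnegative: e^u bounds u from above, c e^{-2u} bounds it from below
because c > 0, and the square bounds the velocity. -/
theorem exists_norm_le_of_energy_le {c : ℝ} (hc : 0 < c) (e : ℝ) :
    ∃ R : ℝ, 0 < R ∧ ∀ x : ℝ × ℝ, energy c x ≤ e → ‖x‖ ≤ R := by
  refine ⟨max (max (|e|) (2 * |e| / c)) (8 * |e| + 1), ?_, fun x hx => ?_⟩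
  · exact lt_max_of_lt_right (by positivity)
  · unfold energy at hx
    have h1 := sq_nonneg x.2
    have h2 := Real.add_one_le_exp x.1
    have h3 := Real.add_one_le_exp (-2 * x.1)
    have h4 := Real.exp_pos x.1
    have h5 := mul_pos (half_pos hc) (Real.exp_pos (-2 * x.1))
    have he := le_abs_self e
    rw [Prod.norm_def, Real.norm_eq_abs, Real.norm_eq_abs, max_le_iff]
    constructor
    · refine le_max_of_le_left ?_
      rcases le_total 0 x.1 with h0 | h0
      · rw [abs_of_nonneg h0]
        exact le_max_of_le_left (by linarith)
      · rw [abs_of_nonpos h0]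
        refine le_max_of_le_right ?_
        rw [le_div_iff₀ hc]
        have h6 : Real.exp (-2 * x.1) ≥ -x.1 := by linarith
        nlinarith [mul_le_mul_of_nonneg_left h6 hc.le]
    · refine le_max_of_le_right ?_
      have h7 : x.2 ^ 2 ≤ 8 * |e| := by linarith
      have := sq_abs x.2
      nlinarith [abs_nonneg x.2, abs_nonneg e]

/-- The field is cut off to have compact support, hence to be Lipschitz. The cut-off field is a
scalar multiple of the original one, so it still conserves the energy; its orbit stays in the ball
where the cutoff is 1 and solves the original equation. -/
theorem exists_solution_energyField {c : ℝ} (hc : 0 < c) (x₀ : ℝ × ℝ) :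
    ∃ x : ℝ → ℝ × ℝ, x 0 = x₀ ∧ ∀ t, HasDerivAt x (energyField c (x t)) t := by
  obtain ⟨R, hR, hbd⟩ := exists_norm_le_of_energy_le hc (energy c x₀)
  let χ : ContDiffBump (0 : ℝ × ℝ) := ⟨R, R + 1, hR, by linarith⟩
  let g : ℝ × ℝ → ℝ × ℝ := fun x => χ x • energyField c x
  have hg : ContDiff ℝ (⊤ : ℕ∞) g := χ.contDiff.smul (contDiff_energyField c)
  obtain ⟨K, hK⟩ := ContDiff.lipschitzWith_of_hasCompactSupport
    (χ.hasCompactSupport.smul_right (f' := energyField c)) hg (by simp)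
  obtain ⟨x, hx0, hx⟩ := exists_global_solution hK x₀
  refine ⟨x, hx0, fun t => ?_⟩
  have h1 : ∀ t, HasDerivAt (fun t => (x t).1) (χ (x t) * (x t).2) t := fun t =>
    (hx t).hasFDerivAt.fst.hasDerivAt.congr_deriv (by simp [energyField])
  have h2 : ∀ t, HasDerivAt (fun t => (x t).2)
      (χ (x t) * (-4 * Real.exp (x t).1 + 4 * c * Real.exp (-2 * (x t).1))) t := fun t =>
    (hx t).hasFDerivAt.snd.hasDerivAt.congr_deriv (by simp [energyField])
  have hE : ∀ t, HasDerivAt (fun t => energy c (x t)) 0 t := by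
    intro t
    have h := ((((h2 t).pow 2).div_const 8).add (h1 t).exp).add
      ((((h1 t).const_mul (-2)).exp).const_mul (c / 2))
    refine h.congr_deriv ?_
    simp only [Nat.cast_ofNat, Nat.add_one_sub_one, pow_one]
    ring
  have hconst : energy c (x t) = energy c x₀ := by
    rw [← hx0]
    exact is_const_of_deriv_eq_zero (fun t => (hE t).differentiableAt) (fun t => (hE t).deriv) t 0
  have hχ : χ (x t) = 1 :=
    χ.one_of_mem_closedBall (mem_closedBall_zero_iff.2 (hbd _ hconst.le))
  simpa [g, hχ] using hx t

variable {a b : ℂ}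

theorem exists_isMetricExponent (ha : a ≠ 0) (hb : b ≠ 0) : ∃ u, IsMetricExponent a b u := by
  have hψ : 0 < ‖psi a b‖ ^ 2 := by
    have : psi a b ≠ 0 := by simp [psi, ha, hb]
    positivity
  obtain ⟨x, hx0, hx⟩ := exists_solution_energyField hψ (Real.log (‖a‖ ^ 2), 0)
  have h1 : ∀ t, HasDerivAt (fun t => (x t).1) (x t).2 t := fun t =>
    (hx t).hasFDerivAt.fst.hasDerivAt.congr_deriv (by simp [energyField])
  have h2 : ∀ t, HasDerivAt (fun t => (x t).2) (energyField (‖psi a b‖ ^ 2) (x t)).2 t := fun t =>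
    (hx t).hasFDerivAt.snd.hasDerivAt.congr_deriv (by simp)
  have d1 : deriv (fun t => (x t).1) = fun t => (x t).2 := funext fun t => (h1 t).deriv
  have d2 : deriv (fun t => (x t).2) = fun t => (energyField (‖psi a b‖ ^ 2) (x t)).2 :=
    funext fun t => (h2 t).deriv
  have hx' : ∀ n : ℕ, ContDiff ℝ n x := by
    intro n
    induction n with
    | zero => exact contDiff_zero.2 (continuous_iff_continuousAt.2 fun t => (hx t).continuousAt)
    | succ n ih =>
      refine contDiff_succ_iff_deriv (n := (n : WithTop ℕ∞)).2
        ⟨fun t => (hx t).differentiableAt, by simp, ?_⟩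
      rw [show deriv x = fun t => energyField _ (x t) from funext fun t => (hx t).deriv]
      exact ((contDiff_energyField _).of_le (by exact_mod_cast le_top)).comp ih
  refine ⟨fun t => (x t).1, ?_, fun y => ?_, ?_, ?_⟩
  · exact (contDiff_infty.2 hx').fst
  · rw [d1, d2]
    simp only [energyField]
    ring
  · rw [hx0]
    exact Real.exp_log (by positivity)
  · rw [d1]
    simp [hx0]

namespace IsMetricExponent

variable {u : ℝ → ℝ}

theorem contDiff_deriv (hu : IsMetricExponent a b u) : ContDiff ℝ (⊤ : ℕ∞) (deriv u) :=
  (contDiff_infty_iff_deriv.1 hu.smooth).2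

theorem hasDerivAt (hu : IsMetricExponent a b u) (y : ℝ) : HasDerivAt u (deriv u y) y :=
  (hu.smooth.differentiable (by simp) y).hasDerivAt

theorem hasDerivAt_deriv (hu : IsMetricExponent a b u) (y : ℝ) :
    HasDerivAt (deriv u) (-4 * Real.exp (u y) + 4 * ‖psi a b‖ ^ 2 * Real.exp (-2 * u y)) y := by
  have h := (hu.contDiff_deriv.differentiable (by simp) y).hasDerivAt
  refine h.congr_deriv ?_
  linarith [hu.gauss y]

/-- Energy conservation, with the constant evaluated at y = 0 through |ψ| = |a|²|b|. It is the
relation needed to verify the closed formula. -/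
theorem first_integral (ha : a ≠ 0) (hu : IsMetricExponent a b u) (y : ℝ) :
    deriv u y ^ 2 = 8 * (‖a‖ ^ 2 + ‖b‖ ^ 2 / 2 - Real.exp (u y)
      - ‖psi a b‖ ^ 2 / 2 * Real.exp (-2 * u y)) := by
  have hE : ∀ y, HasDerivAt (fun y => energy (‖psi a b‖ ^ 2) (u y, deriv u y)) 0 y := by
    intro y
    have h := ((((hu.hasDerivAt_deriv y).pow 2).div_const 8).add (hu.hasDerivAt y).exp).add
      ((((hu.hasDerivAt y).const_mul (-2)).exp).const_mul (‖psi a b‖ ^ 2 / 2))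
    refine h.congr_deriv ?_
    simp only [Nat.cast_ofNat, Nat.add_one_sub_one, pow_one]
    ring
  have hconst := is_const_of_deriv_eq_zero (fun t => (hE t).differentiableAt)
    (fun t => (hE t).deriv) y 0
  have h0 : Real.exp (-2 * u 0) = (‖a‖ ^ 2)⁻¹ ^ 2 := by
    rw [← hu.exp_zero, ← Real.exp_neg, ← Real.exp_nat_mul]
    congr 1
    push_cast
    ring
  have hψ : ‖psi a b‖ = ‖a‖ ^ 2 * ‖b‖ := by simp [psi]
  simp only [energy, hu.exp_zero, hu.deriv_zero, h0] at hconst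
  have ha' : ‖a‖ ≠ 0 := by simpa using ha
  have e : ‖psi a b‖ ^ 2 / 2 * (‖a‖ ^ 2)⁻¹ ^ 2 = ‖b‖ ^ 2 / 2 := by
    rw [hψ]; field_simp
  rw [e] at hconst
  linarith

end IsMetricExponent

end MetricExponent

/-! ### A reflection principle on the unit disc -/

section Reflection

/-- Two functions that are holomorphic in the unit disc and conjugate to each other on the unit
circle are constant. -/
theorem eq_const_of_conj_on_sphere {f g : ℂ → ℂ} (hfc : ContinuousOn f (Metric.closedBall 0 1))
    (hgc : ContinuousOn g (Metric.closedBall 0 1)) (hf : DifferentiableOn ℂ f (Metric.ball 0 1))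
    (hg : DifferentiableOn ℂ g (Metric.ball 0 1)) (h : ∀ ζ : ℂ, ‖ζ‖ = 1 → g ζ = star (f ζ)) :
    ∀ ζ : ℂ, ‖ζ‖ = 1 → f ζ = f 0 := by
  have hcl : closure (Metric.ball (0 : ℂ) 1) = Metric.closedBall 0 1 :=
    closure_ball 0 one_ne_zero
  -- This product vanishes at the centre and equals |f − f(0)|² on the circle, so by the mean value
  -- property the circle integral of |f − f(0)|² is zero.
  have hwd : DiffContOnCl ℂ (fun ζ => (f ζ - f 0) * (g ζ - star (f 0))) (Metric.ball 0 |1|) := by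
    rw [abs_one]
    refine ⟨(hf.sub_const _).mul (hg.sub_const _), ?_⟩
    rw [hcl]
    exact (hfc.sub continuousOn_const).mul (hgc.sub continuousOn_const)
  have havg := hwd.circleAverage
  rw [sub_self, zero_mul] at havg
  let φ : ℝ → ℝ := fun θ => ‖f (circleMap 0 1 θ) - f 0‖ ^ 2
  have hφ : Continuous φ := by
    have h1 : Continuous fun θ => f (circleMap 0 1 θ) :=
      hfc.comp_continuous (continuous_circleMap 0 1) fun θ =>
        Metric.sphere_subset_closedBall (circleMap_mem_sphere 0 zero_le_one θ)
    exact (h1.sub continuous_const).norm.pow 2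
  have hint : ∫ θ in (0 : ℝ)..2 * Real.pi, φ θ = 0 := by
    rw [Real.circleAverage_def] at havg
    have h2 := (smul_eq_zero.1 havg).resolve_left (by positivity)
    rw [← Complex.ofReal_eq_zero, ← intervalIntegral.integral_ofReal, ← h2]
    congr 1
    ext θ
    have hn : ‖circleMap 0 1 θ‖ = 1 := by simp
    rw [h _ hn, ← star_sub, Complex.star_def, Complex.mul_conj, Complex.normSq_eq_norm_sq]
  intro ζ hζ
  by_contra hne
  obtain ⟨θ, hθ, rfl⟩ : ζ ∈ circleMap 0 1 '' Ioc 0 (2 * Real.pi) := by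
    rw [image_circleMap_Ioc, abs_one]
    simpa using hζ
  refine (intervalIntegral.integral_pos (by positivity) hφ.continuousOn
    (fun _ _ => by positivity) ⟨θ, Ioc_subset_Icc_self hθ, ?_⟩).ne' hint
  have := norm_pos_iff.2 (sub_ne_zero.2 hne)
  positivity

end Reflection

end MinLag

namespace MinLag

open Complex Matrix

attribute [local instance] Matrix.linftyOpNormedRing Matrix.linftyOpNormedAlgebra

theorem hasDerivAt_matrix_iff {f : ℝ → M3} {f' : M3} {y : ℝ} :
    HasDerivAt f f' y ↔ ∀ i j, HasDerivAt (fun s => f s i j) (f' i j) y :=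
  hasDerivAt_pi.trans (forall_congr' fun _ => hasDerivAt_pi)

theorem hasDerivAt_matrix_inv {f : ℝ → M3} {f' : M3} {y : ℝ} (hf : HasDerivAt f f' y)
    (h : IsUnit (f y)) : HasDerivAt (fun s => (f s)⁻¹) (-((f y)⁻¹ * f' * (f y)⁻¹)) y := by
  obtain ⟨x, hx⟩ := h
  have h1 := hasFDerivAt_ringInverse (𝕜 := ℝ) x
  rw [hx] at h1
  have h2 := h1.comp_hasDerivAt y hf
  have e : (f y)⁻¹ = (↑x⁻¹ : M3) := by rw [← hx, Matrix.coe_units_inv]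
  rw [e]
  have e2 : (fun s => (f s)⁻¹) = Ring.inverse ∘ f :=
    funext fun s => Matrix.nonsing_inv_eq_ringInverse (f s)
  rw [e2]
  exact h2.congr_deriv (by simp)

/-! ### The Lax equation and the Hermitian structure -/

section Lax

variable (a b : ℂ) (u : ℝ → ℝ)

/-- The coefficient matrix of the linear equation `T' = ζ B T` of the plus factor. -/
noncomputable def laxB (y : ℝ) : M3 :=
  !![0, -2 * star (psi a b) * a ^ 2 * ((Real.exp (u y) : ℂ)⁻¹) ^ 2, 0;
     0, 0, -2 * I * Real.exp (u y) * a⁻¹;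
     -2 * I * Real.exp (u y) * a⁻¹, 0, 0]

/-- The derivative of `laxB`. -/
noncomputable def laxB' (y : ℝ) : M3 :=
  !![0, 4 * star (psi a b) * a ^ 2 * ((Real.exp (u y) : ℂ)⁻¹) ^ 2 * deriv u y, 0;
     0, 0, -2 * I * Real.exp (u y) * a⁻¹ * deriv u y;
     -2 * I * Real.exp (u y) * a⁻¹ * deriv u y, 0, 0]

/-- The Lax matrix `N = T D T⁻¹`. -/
noncomputable def laxN (y : ℝ) (ζ : ℂ) : M3 :=
  !![-I * deriv u y / 2, I * ζ * star (psi a b) * a ^ 2 * ((Real.exp (u y) : ℂ)⁻¹) ^ 2, ζ⁻¹ * a;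
     ζ⁻¹ * b, I * deriv u y / 2, -ζ * Real.exp (u y) * a⁻¹;
     -ζ * Real.exp (u y) * a⁻¹, ζ⁻¹ * a, 0]

/-- The matrix `K = i N - ζ B` of the derivative of the frame in the direction `i`. -/
noncomputable def laxK (y : ℝ) (ζ : ℂ) : M3 := I • laxN a b u y ζ - ζ • laxB a b u y

variable {a b u}

theorem hasDerivAt_exp_metric (hu : IsMetricExponent a b u) (y : ℝ) :
    HasDerivAt (fun y => (Real.exp (u y) : ℂ)) (Real.exp (u y) * deriv u y) y := by
  have := (hu.hasDerivAt y).exp.ofReal_comp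
  simpa using this

theorem hasDerivAt_exp_metric_inv (hu : IsMetricExponent a b u) (y : ℝ) :
    HasDerivAt (fun y => (Real.exp (u y) : ℂ)⁻¹) (-((Real.exp (u y) : ℂ)⁻¹ * deriv u y)) y := by
  have hE : (Real.exp (u y) : ℂ) ≠ 0 := by exact_mod_cast (Real.exp_pos _).ne'
  refine ((hasDerivAt_exp_metric hu y).fun_inv hE).congr_deriv ?_
  field_simp

theorem hasDerivAt_deriv_metric (hu : IsMetricExponent a b u) (y : ℝ) :
    HasDerivAt (fun y => ((deriv u y : ℝ) : ℂ))
      (-4 * Real.exp (u y) + 4 * (psi a b * star (psi a b)) * (Real.exp (u y) : ℂ)⁻¹ ^ 2) y := by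
  have := (hu.hasDerivAt_deriv y).ofReal_comp
  refine this.congr_deriv ?_
  have h1 : psi a b * star (psi a b) = ((‖psi a b‖ ^ 2 : ℝ) : ℂ) := by
    rw [star_def, mul_conj, normSq_eq_norm_sq]
  have h2 : (Real.exp (-2 * u y)) = (Real.exp (u y))⁻¹ ^ 2 := by
    rw [← Real.exp_neg, ← Real.exp_nat_mul]; congr 1; push_cast; ring
  rw [h1, h2]
  push_cast
  ring

theorem hasDerivAt_laxB (hu : IsMetricExponent a b u) (y : ℝ) :
    HasDerivAt (laxB a b u) (laxB' a b u y) y := by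
  have h1 := hasDerivAt_exp_metric hu y
  have h2 := ((hasDerivAt_exp_metric_inv hu y).fun_pow 2).const_mul (-2 * star (psi a b) * a ^ 2)
  have h3 := (h1.const_mul (-2 * I)).mul_const a⁻¹
  rw [hasDerivAt_matrix_iff]
  intro i j
  fin_cases i <;> fin_cases j
  all_goals first
    | exact hasDerivAt_const y (0 : ℂ)
    | exact h2.congr_deriv (by simp [laxB']; ring)
    | exact h3.congr_deriv (by simp [laxB']; ring)

/-- The equation for u enters only through the diagonal entries ∓iu'/2; the other entries need only
the chain rule. -/
theorem hasDerivAt_laxN (ha : a ≠ 0) (hu : IsMetricExponent a b u) (y : ℝ) {ζ : ℂ} (hζ : ζ ≠ 0) :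
    HasDerivAt (fun y => laxN a b u y ζ)
      (ζ • (laxB a b u y * laxN a b u y ζ) - ζ • (laxN a b u y ζ * laxB a b u y)) y := by
  have hE : (Real.exp (u y) : ℂ) ≠ 0 := by exact_mod_cast (Real.exp_pos _).ne'
  have h1 := ((hasDerivAt_exp_metric hu y).const_mul (-ζ)).mul_const a⁻¹
  have h2 := ((hasDerivAt_exp_metric_inv hu y).fun_pow 2).const_mul
    (I * ζ * star (psi a b) * a ^ 2)
  have h3 := ((hasDerivAt_deriv_metric hu y).const_mul (-I)).div_const 2
  have h4 := ((hasDerivAt_deriv_metric hu y).const_mul I).div_const 2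
  have hψ : psi a b = -I * a ^ 2 * b := rfl
  have hI := I_sq
  rw [hasDerivAt_matrix_iff]
  have h0 : ∀ c : ℂ, HasDerivAt (fun _ : ℝ => c) 0 y := hasDerivAt_const y
  intro i j
  fin_cases i <;> fin_cases j
  on_goal 1 => refine h3.congr_deriv ?_
  on_goal 2 => refine h2.congr_deriv ?_
  on_goal 3 => refine (h0 _).congr_deriv ?_
  on_goal 4 => refine (h0 _).congr_deriv ?_
  on_goal 5 => refine h4.congr_deriv ?_
  on_goal 6 => refine h1.congr_deriv ?_
  on_goal 7 => refine h1.congr_deriv ?_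
  on_goal 8 => refine (h0 _).congr_deriv ?_
  on_goal 9 => refine (h0 _).congr_deriv ?_
  all_goals
    clear h0 h1 h2 h3 h4
    simp only [laxB, laxN]
    generalize (Real.exp (u y) : ℂ) = E at hE ⊢
    generalize ((deriv u y : ℝ) : ℂ) = p
    generalize star (psi a b) = q
    try rw [hψ]
    simp
    try grind

theorem laxN_zero (ha : a ≠ 0) (hu : IsMetricExponent a b u) (ζ : ℂ) :
    laxN a b u 0 ζ = potential a b ζ := by
  have hA : (Real.exp (u 0) : ℂ) = a * star a := by
    rw [hu.exp_zero, star_def, mul_conj, normSq_eq_norm_sq]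
  have ha' : star a ≠ 0 := by simpa using ha
  have hI := I_sq
  have hψ : star (psi a b) = I * star a ^ 2 * star b := by simp [psi]
  simp only [laxN, potential, hA, hu.deriv_zero, hψ]
  generalize star a = a' at ha' ⊢
  generalize star b = b'
  ext i j
  fin_cases i <;> fin_cases j <;> simp <;> grind

/-- B is 2i times the coefficient of ζ in N, so subtracting ζB from iN reverses the sign of that
part. -/
theorem laxK_eq (y : ℝ) (ζ : ℂ) : laxK a b u y ζ =
    !![((deriv u y : ℝ) : ℂ) / 2, ζ * star (psi a b) * a ^ 2 * ((Real.exp (u y) : ℂ)⁻¹) ^ 2, I * ζ⁻¹ * a;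
     I * ζ⁻¹ * b, -((deriv u y : ℝ) : ℂ) / 2, I * ζ * Real.exp (u y) * a⁻¹;
     I * ζ * Real.exp (u y) * a⁻¹, I * ζ⁻¹ * a, 0] := by
  have hI := I_sq
  simp only [laxK, laxN, laxB]
  generalize (Real.exp (u y) : ℂ) = E
  generalize ((deriv u y : ℝ) : ℂ) = p
  generalize star (psi a b) = q
  ext i j
  fin_cases i <;> fin_cases j <;> simp <;> grind

/-- The third column of `N² + K² + K'`. -/
theorem lax_laplacian (ha : a ≠ 0) {y : ℝ} {ζ : ℂ} (hζ : ζ ≠ 0) (i : Fin 3) :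
    (laxN a b u y ζ * laxN a b u y ζ + laxK a b u y ζ * laxK a b u y ζ +
      (I • (ζ • (laxB a b u y * laxN a b u y ζ) - ζ • (laxN a b u y ζ * laxB a b u y)) -
        ζ • laxB' a b u y)) i 2 = ![0, 0, -4 * (Real.exp (u y) : ℂ)] i := by
  have hE : (Real.exp (u y) : ℂ) ≠ 0 := by exact_mod_cast (Real.exp_pos _).ne'
  have hI := I_sq
  simp only [laxK, laxN, laxB, laxB']
  generalize (Real.exp (u y) : ℂ) = E at hE ⊢
  generalize ((deriv u y : ℝ) : ℂ) = p
  generalize star (psi a b) = q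
  fin_cases i <;> simp <;> grind

/-- The matrix `Q₀* Q₀` of the metric. -/
noncomputable def metricDiag (a : ℂ) (u : ℝ → ℝ) (y : ℝ) : M3 :=
  diagonal ![(Real.exp (u y) : ℂ) * (a * star a)⁻¹, (a * star a) * (Real.exp (u y) : ℂ)⁻¹, 1]

/-- The inverse of `metricDiag`. -/
noncomputable def metricDiagInv (a : ℂ) (u : ℝ → ℝ) (y : ℝ) : M3 :=
  diagonal ![(a * star a) * (Real.exp (u y) : ℂ)⁻¹, Real.exp (u y) * (a * star a)⁻¹, 1]

theorem star_inv_of_norm_eq_one {ζ : ℂ} (hζ : ‖ζ‖ = 1) : star ζ = ζ⁻¹ := by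
  rw [star_def, Complex.inv_def, normSq_eq_norm_sq, hζ]
  simp

theorem hasDerivAt_metricDiagInv (hu : IsMetricExponent a b u) (y : ℝ) :
    HasDerivAt (metricDiagInv a u)
      (diagonal ![-((deriv u y : ℝ) : ℂ), ((deriv u y : ℝ) : ℂ), 0] * metricDiagInv a u y) y := by
  have h1 := (hasDerivAt_exp_metric_inv hu y).const_mul (a * star a)
  have h2 := (hasDerivAt_exp_metric hu y).mul_const (a * star a)⁻¹
  rw [hasDerivAt_matrix_iff]
  intro i j
  fin_cases i <;> fin_cases j
  all_goals first
    | exact (hasDerivAt_const y (0 : ℂ)).congr_deriv (by simp [metricDiagInv])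
    | exact h1.congr_deriv (by simp [metricDiagInv]; ring)
    | exact h2.congr_deriv (by simp [metricDiagInv]; ring)
    | exact (hasDerivAt_const y (1 : ℂ)).congr_deriv (by simp [metricDiagInv])

/-- This is the infinitesimal form of R `metricDiagInv` R* being constant along y, given R_y = RK.
-/
theorem laxK_conj (ha : a ≠ 0) {y : ℝ} {ζ : ℂ} (hζ : ‖ζ‖ = 1) :
    laxK a b u y ζ * metricDiagInv a u y +
      diagonal ![-((deriv u y : ℝ) : ℂ), ((deriv u y : ℝ) : ℂ), 0] * metricDiagInv a u y +
      metricDiagInv a u y * (laxK a b u y ζ)ᴴ = 0 := by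
  have hE : (Real.exp (u y) : ℂ) ≠ 0 := by exact_mod_cast (Real.exp_pos _).ne'
  have hE' : star (Real.exp (u y) : ℂ) = Real.exp (u y) := conj_ofReal _
  have hp' : star ((deriv u y : ℝ) : ℂ) = ((deriv u y : ℝ) : ℂ) := conj_ofReal _
  have ha' : star a ≠ 0 := by simpa using ha
  have hz := star_inv_of_norm_eq_one hζ
  have hz0 : ζ ≠ 0 := by rintro rfl; simp at hζ
  have hI := I_sq
  have hψ : star (psi a b) = I * star a ^ 2 * star b := by simp [psi]
  simp only [laxK_eq, metricDiagInv, hψ]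
  generalize (Real.exp (u y) : ℂ) = E at hE hE' ⊢
  generalize ((deriv u y : ℝ) : ℂ) = p at hp' ⊢
  simp only [star_def] at *
  ext i j
  fin_cases i <;> fin_cases j <;>
    simp [Matrix.vecMul_diagonal, hE', hp', hz] <;>
    generalize (starRingEnd ℂ) a = a' at ha' ⊢ <;> generalize (starRingEnd ℂ) b = b' <;> grind

end Lax

end MinLag

/-! ### The plus flow T and the frame R = exp(zD) T⁻¹ -/

namespace MinLag

open Complex Matrix

attribute [local instance] Matrix.linftyOpNormedRing Matrix.linftyOpNormedAlgebra

/-- `T` solves `T' = ζ B T`, `T(0) = 1`, and is entire in `ζ`. -/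
structure IsPlusFlow (a b : ℂ) (u : ℝ → ℝ) (T : ℝ → ℂ → M3) : Prop where
  zero : ∀ ζ, T 0 ζ = 1
  hasDerivAt : ∀ y ζ, HasDerivAt (fun s => T s ζ) (ζ • (laxB a b u y * T y ζ)) y
  entire : ∀ y i j, Differentiable ℂ fun ζ => T y ζ i j

variable {a b : ℂ} {u : ℝ → ℝ} {T : ℝ → ℂ → M3}

theorem exists_isPlusFlow (hu : IsMetricExponent a b u) : ∃ T, IsPlusFlow a b u T := by
  have hB : Continuous (laxB a b u) :=
    continuous_iff_continuousAt.2 fun y => (hasDerivAt_laxB hu y).continuousAt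
  obtain ⟨T, h0, h1, h2⟩ := exists_entire_linear_solution hB
  refine ⟨T, h0, h1, fun y i j ζ => ?_⟩
  exact differentiableAt_pi.1 (differentiableAt_pi.1 (h2 y ζ) i) j

namespace IsPlusFlow

/-- The determinant is constant because `laxB` has trace zero. -/
theorem det_eq_one (hT : IsPlusFlow a b u T) (y : ℝ) (ζ : ℂ) : (T y ζ).det = 1 := by
  have hd : ∀ y, HasDerivAt (fun s => (T s ζ).det) 0 y := by
    intro y
    have h := fun i j => (hasDerivAt_matrix_iff.1 (hT.hasDerivAt y ζ)) i j
    simp only [Matrix.det_fin_three]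
    have := ((((((h 0 0).fun_mul (h 1 1)).fun_mul (h 2 2)).fun_sub
      (((h 0 0).fun_mul (h 1 2)).fun_mul (h 2 1))).fun_sub
      (((h 0 1).fun_mul (h 1 0)).fun_mul (h 2 2))).fun_add
      (((h 0 1).fun_mul (h 1 2)).fun_mul (h 2 0))).fun_add
      (((h 0 2).fun_mul (h 1 0)).fun_mul (h 2 1)) |>.fun_sub
      (((h 0 2).fun_mul (h 1 1)).fun_mul (h 2 0))
    refine this.congr_deriv ?_
    simp only [Matrix.smul_apply, Matrix.mul_apply, Fin.sum_univ_three, smul_eq_mul]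
    simp [laxB]
    ring
  have := is_const_of_deriv_eq_zero (fun t => (hd t).differentiableAt) (fun t => (hd t).deriv) y 0
  rw [this, hT.zero, Matrix.det_one]

theorem isUnit_det (hT : IsPlusFlow a b u T) (y : ℝ) (ζ : ℂ) : IsUnit (T y ζ).det := by
  rw [hT.det_eq_one]; exact isUnit_one

theorem inv_mul (hT : IsPlusFlow a b u T) (y : ℝ) (ζ : ℂ) : (T y ζ)⁻¹ * T y ζ = 1 :=
  Matrix.nonsing_inv_mul _ (hT.isUnit_det y ζ)

theorem mul_inv (hT : IsPlusFlow a b u T) (y : ℝ) (ζ : ℂ) : T y ζ * (T y ζ)⁻¹ = 1 :=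
  Matrix.mul_nonsing_inv _ (hT.isUnit_det y ζ)

theorem hasDerivAt_inv (hT : IsPlusFlow a b u T) (y : ℝ) (ζ : ℂ) :
    HasDerivAt (fun s => (T s ζ)⁻¹) (-(ζ • ((T y ζ)⁻¹ * laxB a b u y))) y := by
  refine (hasDerivAt_matrix_inv (hT.hasDerivAt y ζ)
    ((Matrix.isUnit_iff_isUnit_det _).2 (hT.isUnit_det y ζ))).congr_deriv ?_
  rw [mul_smul_comm, smul_mul_assoc, Matrix.mul_assoc, Matrix.mul_assoc, hT.mul_inv, Matrix.mul_one]

/-- Uniqueness for the linear equation: T⁻¹X has derivative zero. It serves three times, for the Lax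
relation, for the twisting of T and for the closed formula. -/
theorem eq_of_hasDerivAt (hT : IsPlusFlow a b u T) {X : ℝ → M3} {ζ : ℂ}
    (hX : ∀ y, HasDerivAt X (ζ • (laxB a b u y * X y)) y) (y : ℝ) : X y = T y ζ * X 0 := by
  have hd : ∀ y, HasDerivAt (fun s => (T s ζ)⁻¹ * X s) (0 : M3) y := by
    intro y
    refine ((hT.hasDerivAt_inv y ζ).fun_mul (hX y)).congr_deriv ?_
    rw [neg_mul, smul_mul_assoc, mul_smul_comm, Matrix.mul_assoc, neg_add_cancel]
  have h := is_const_of_deriv_eq_zero (fun t => (hd t).differentiableAt) (fun t => (hd t).deriv) y 0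
  simp only [hT.zero, inv_one, one_mul] at h
  rw [← h, ← Matrix.mul_assoc, hT.mul_inv, Matrix.one_mul]

theorem lax (hT : IsPlusFlow a b u T) (ha : a ≠ 0) (hu : IsMetricExponent a b u) (y : ℝ) {ζ : ℂ}
    (hζ : ζ ≠ 0) : laxN a b u y ζ * T y ζ = T y ζ * potential a b ζ := by
  have h := hT.eq_of_hasDerivAt (X := fun y => laxN a b u y ζ * T y ζ) (ζ := ζ) (fun y => ?_) y
  · simpa [hT.zero, laxN_zero ha hu] using h
  · refine ((hasDerivAt_laxN ha hu y hζ).fun_mul (hT.hasDerivAt y ζ)).congr_deriv ?_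
    rw [sub_mul, smul_mul_assoc, smul_mul_assoc, mul_smul_comm, Matrix.mul_assoc, Matrix.mul_assoc,
      sub_add_cancel]

theorem potential_mul_inv (hT : IsPlusFlow a b u T) (ha : a ≠ 0) (hu : IsMetricExponent a b u)
    (y : ℝ) {ζ : ℂ} (hζ : ζ ≠ 0) :
    potential a b ζ * (T y ζ)⁻¹ = (T y ζ)⁻¹ * laxN a b u y ζ := by
  calc potential a b ζ * (T y ζ)⁻¹
      = (T y ζ)⁻¹ * (T y ζ * potential a b ζ) * (T y ζ)⁻¹ := by
        rw [← Matrix.mul_assoc, hT.inv_mul, Matrix.one_mul]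
    _ = (T y ζ)⁻¹ * laxN a b u y ζ * (T y ζ * (T y ζ)⁻¹) := by
        rw [← hT.lax ha hu y hζ]; simp only [Matrix.mul_assoc]
    _ = _ := by rw [hT.mul_inv, Matrix.mul_one]

end IsPlusFlow

theorem hasDerivAt_conjTranspose {X : ℝ → M3} {X' : M3} {y : ℝ} (h : HasDerivAt X X' y) :
    HasDerivAt (fun s => (X s)ᴴ) X'ᴴ y := by
  rw [hasDerivAt_matrix_iff] at h ⊢
  intro i j
  exact (h j i).star

theorem metricDiagInv_zero (ha : a ≠ 0) (hu : IsMetricExponent a b u) :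
    metricDiagInv a u 0 = 1 := by
  have hA : (Real.exp (u 0) : ℂ) = a * star a := by
    rw [hu.exp_zero, star_def, mul_conj, normSq_eq_norm_sq]
  have h0 : a * star a ≠ 0 := by simp [ha]
  rw [metricDiagInv, hA, mul_inv_cancel₀ h0, ← Matrix.diagonal_one]
  congr 1
  ext i
  fin_cases i <;> rfl

theorem metricDiag_mul_inv (ha : a ≠ 0) (y : ℝ) :
    metricDiag a u y * metricDiagInv a u y = 1 := by
  have hE : (Real.exp (u y) : ℂ) ≠ 0 := by exact_mod_cast (Real.exp_pos _).ne'
  have h0 : a * star a ≠ 0 := by simp [ha]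
  rw [metricDiag, metricDiagInv, Matrix.diagonal_mul_diagonal, ← Matrix.diagonal_one]
  congr 1
  ext i
  generalize (Real.exp (u y) : ℂ) = E at hE ⊢
  generalize a * star a = A at h0 ⊢
  fin_cases i <;> simp <;> field_simp

theorem potential_conjTranspose {ζ : ℂ} (hζ : ‖ζ‖ = 1) :
    (potential a b ζ)ᴴ = -potential a b ζ := by
  have hz := star_inv_of_norm_eq_one hζ
  rw [star_def] at hz
  ext i j
  fin_cases i <;> fin_cases j <;> simp [potential, hz]

/-- The frame `exp (z D) T⁻¹`, unitary up to the diagonal factor of the metric. -/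
noncomputable def frameR (a b : ℂ) (T : ℝ → ℂ → M3) (ζ z : ℂ) : M3 :=
  NormedSpace.exp (z • potential a b ζ) * (T z.im ζ)⁻¹

namespace IsPlusFlow

/-- Since D T⁻¹ = T⁻¹N, the exponential contributes RN dz, and T⁻¹ contributes −ζRB dy. Collecting
dy gives R(iN − ζB) = RK. -/
theorem hasFDerivAt_frameR (hT : IsPlusFlow a b u T) (ha : a ≠ 0) (hu : IsMetricExponent a b u)
    {ζ : ℂ} (hζ : ζ ≠ 0) (z : ℂ) :
    HasFDerivAt (frameR a b T ζ)
      (reCLM.smulRight (frameR a b T ζ z * laxN a b u z.im ζ) +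
        imCLM.smulRight (frameR a b T ζ z * laxK a b u z.im ζ)) z := by
  have h1 := (hasDerivAt_exp_smul_const (potential a b ζ) z).hasFDerivAt.restrictScalars ℝ
  have h2 := (hT.hasDerivAt_inv z.im ζ).hasFDerivAt.comp z (imCLM.hasFDerivAt (x := z))
  have h3 := h1.mul' h2
  refine h3.congr_fderiv ?_
  ext1 v
  have hv : v = v.re + v.im * I := (re_add_im v).symm
  have e1 : v • (NormedSpace.exp (z • potential a b ζ) * potential a b ζ * (T z.im ζ)⁻¹) =
      v.re • (frameR a b T ζ z * laxN a b u z.im ζ) +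
      v.im • (frameR a b T ζ z * (I • laxN a b u z.im ζ)) := by
    rw [Matrix.mul_assoc, hT.potential_mul_inv ha hu z.im hζ, ← Matrix.mul_assoc]
    change v • (frameR a b T ζ z * _) = _
    conv_lhs => rw [hv, add_smul, mul_smul]
    rw [mul_smul_comm]
    rfl
  change NormedSpace.exp (z • potential a b ζ) *
      (v.im • -(ζ • ((T z.im ζ)⁻¹ * laxB a b u z.im))) +
      v • (NormedSpace.exp (z • potential a b ζ) * potential a b ζ) * (T z.im ζ)⁻¹ =
    v.re • (frameR a b T ζ z * laxN a b u z.im ζ) + v.im • (frameR a b T ζ z * laxK a b u z.im ζ)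
  rw [smul_mul_assoc, e1, laxK, Matrix.mul_sub, smul_sub, mul_smul_comm, mul_neg, mul_smul_comm,
    ← Matrix.mul_assoc, mul_smul_comm, smul_neg]
  change -(v.im • ζ • (frameR a b T ζ z * laxB a b u z.im)) + _ = _
  simp only [mul_smul_comm]
  abel

/-- Along the imaginary axis this is `laxK_conj`, with value 1 at the origin. A shift by x
multiplies R on the left by exp(xD), unitary because D is skew-Hermitian on the circle. -/
theorem frameR_conj (hT : IsPlusFlow a b u T) (ha : a ≠ 0) (hu : IsMetricExponent a b u)
    {ζ : ℂ} (hζ : ‖ζ‖ = 1) (z : ℂ) :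
    frameR a b T ζ z * metricDiagInv a u z.im * (frameR a b T ζ z)ᴴ = 1 := by
  have hζ0 : ζ ≠ 0 := by rintro rfl; simp at hζ
  let H : ℝ → M3 := fun y => frameR a b T ζ (y * I)
  have hH : ∀ y, HasDerivAt H (H y * laxK a b u y ζ) y := by
    intro y
    have h1 : HasDerivAt (fun y : ℝ => (y * I : ℂ)) I y := by
      simpa using (ofRealCLM.hasDerivAt (x := y)).mul_const I
    have h2 := (hT.hasFDerivAt_frameR ha hu hζ0 (y * I)).comp_hasDerivAt y h1
    refine h2.congr_deriv ?_
    change I.re • (frameR a b T ζ (y * I) * laxN a b u (y * I : ℂ).im ζ) +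
      I.im • (frameR a b T ζ (y * I) * laxK a b u (y * I : ℂ).im ζ) = _
    simp [H]
  have hd : ∀ y, HasDerivAt (fun y => H y * metricDiagInv a u y * (H y)ᴴ) (0 : M3) y := by
    intro y
    refine (((hH y).fun_mul (hasDerivAt_metricDiagInv hu y)).fun_mul
      (hasDerivAt_conjTranspose (hH y))).congr_deriv ?_
    rw [← Matrix.mul_zero (H y), ← Matrix.zero_mul (H y)ᴴ, ← laxK_conj ha hζ,
      Matrix.conjTranspose_mul]
    noncomm_ring
  have hH1 : ∀ y, H y * metricDiagInv a u y * (H y)ᴴ = 1 := by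
    intro y
    rw [is_const_of_deriv_eq_zero (fun t => (hd t).differentiableAt) (fun t => (hd t).deriv) y 0]
    have hH0 : H 0 = 1 := by simp [H, frameR, hT.zero]
    rw [hH0, metricDiagInv_zero ha hu]
    simp
  have hz : frameR a b T ζ z = NormedSpace.exp ((z.re : ℂ) • potential a b ζ) * H z.im := by
    simp only [H, frameR]
    rw [← Matrix.mul_assoc, ← Matrix.exp_add_of_commute, ← add_smul, re_add_im]
    · simp
    · exact ((Commute.refl _).smul_left _).smul_right _
  have hexp : NormedSpace.exp ((z.re : ℂ) • potential a b ζ) *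
      (NormedSpace.exp ((z.re : ℂ) • potential a b ζ))ᴴ = 1 := by
    rw [← Matrix.exp_conjTranspose, Matrix.conjTranspose_smul, potential_conjTranspose hζ,
      star_def, conj_ofReal, smul_neg, ← Matrix.exp_add_of_commute]
    · simp
    · exact (Commute.refl _).neg_right
  rw [hz, Matrix.conjTranspose_mul]
  calc _ = NormedSpace.exp ((z.re : ℂ) • potential a b ζ) *
        (H z.im * metricDiagInv a u z.im * (H z.im)ᴴ) *
        (NormedSpace.exp ((z.re : ℂ) • potential a b ζ))ᴴ := by simp only [Matrix.mul_assoc]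
    _ = 1 := by rw [hH1, Matrix.mul_one, hexp]

theorem conj_frameR (hT : IsPlusFlow a b u T) (ha : a ≠ 0) (hu : IsMetricExponent a b u)
    {ζ : ℂ} (hζ : ‖ζ‖ = 1) (z : ℂ) :
    (frameR a b T ζ z)ᴴ * frameR a b T ζ z = metricDiag a u z.im := by
  have h := hT.frameR_conj ha hu hζ z
  rw [Matrix.mul_assoc] at h
  have h2 := _root_.mul_eq_one_comm.1 h
  rw [Matrix.mul_assoc] at h2
  calc _ = metricDiag a u z.im * metricDiagInv a u z.im *
        ((frameR a b T ζ z)ᴴ * frameR a b T ζ z) := by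
        rw [metricDiag_mul_inv ha, Matrix.one_mul]
    _ = _ := by rw [Matrix.mul_assoc, h2, Matrix.mul_one]

end IsPlusFlow

end MinLag

namespace MinLag

open Complex Matrix

attribute [local instance] Matrix.linftyOpNormedRing Matrix.linftyOpNormedAlgebra

/-! ### The automorphism σ and its unitary fixed points -/

section Twist

theorem alpha_eq : exp (2 * Real.pi * I / 3) = exp (Real.pi * I / 3) ^ 2 := by
  rw [← Complex.exp_nat_mul]; congr 1; push_cast; ring

theorem epsilon_pow_three : exp (Real.pi * I / 3) ^ 3 = -1 := by
  rw [← Complex.exp_nat_mul, ← Complex.exp_pi_mul_I]; congr 1; push_cast; ring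

theorem norm_epsilon : ‖exp (Real.pi * I / 3)‖ = 1 := by
  rw [Complex.norm_exp]; simp

theorem epsilon_sq_ne_one : exp (Real.pi * I / 3) ^ 2 ≠ 1 := by
  intro h
  have h3 := epsilon_pow_three
  have h1 : exp (Real.pi * I / 3) = -1 := by
    rw [pow_succ, h, one_mul] at h3; exact h3
  have h2 := congrArg Complex.im h1
  rw [Complex.exp_im] at h2
  have e1 : (Real.pi * I / 3 : ℂ).im = Real.pi / 3 := by simp
  have e2 : (Real.pi * I / 3 : ℂ).re = 0 := by simp
  rw [e1, e2] at h2
  simp at h2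

theorem isUnit_det_twistP : IsUnit twistP.det := by
  have h : twistP.det = -(exp (Real.pi * I / 3) ^ 3) ^ 2 := by
    simp [twistP, Matrix.det_fin_three, alpha_eq]; ring
  rw [h, epsilon_pow_three]
  norm_num

theorem sigma_mul (A B : M3) : sigma (A * B) = sigma A * sigma B := by
  simp only [sigma, Matrix.transpose_mul, Matrix.mul_inv_rev]
  calc _ = twistP * (Aᵀ)⁻¹ * (1 * (Bᵀ)⁻¹) * twistP⁻¹ := by
        rw [Matrix.one_mul]; simp only [Matrix.mul_assoc]
    _ = _ := by
        rw [← Matrix.nonsing_inv_mul _ isUnit_det_twistP]; simp only [Matrix.mul_assoc]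

theorem sigma_eq_iff {A B : M3} : sigma A = B ↔ twistP * (Aᵀ)⁻¹ = B * twistP := by
  constructor
  · rintro rfl
    rw [sigma, Matrix.mul_assoc, Matrix.nonsing_inv_mul _ isUnit_det_twistP, Matrix.mul_one]
  · intro h
    rw [sigma, h, Matrix.mul_assoc, Matrix.mul_nonsing_inv _ isUnit_det_twistP, Matrix.mul_one]

/-- A unitary matrix of determinant one that is fixed by `σ` fixes `e₃`. -/
theorem column_of_sigma_fixed {c : M3} (hc : cᴴ * c = 1) (hd : c.det = 1) (hs : sigma c = c)
    (i : Fin 3) : c i 2 = (1 : M3) i 2 := by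
  -- For unitary c the fixed-point equation becomes P c̄ = c P, which is compared entry by entry.
  have hinv : (cᵀ)⁻¹ = (cᴴ)ᵀ := by
    rw [← Matrix.transpose_nonsing_inv]
    congr 1
    exact Matrix.inv_eq_left_inv hc
  rw [sigma_eq_iff, hinv] at hs
  have hε := norm_epsilon
  have h3 := epsilon_pow_three
  have h2 := epsilon_sq_ne_one
  have hstar := star_inv_of_norm_eq_one hε
  have h0 : exp (Real.pi * I / 3) ≠ 0 := Complex.exp_ne_zero _
  have hP : twistP = !![0, exp (Real.pi * I / 3) ^ 2, 0; exp (Real.pi * I / 3) ^ 4, 0, 0; 0, 0, 1] := by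
    rw [twistP, alpha_eq, ← pow_mul]
  rw [hP] at hs
  generalize exp (Real.pi * I / 3) = ε at *
  have e := fun i j => congrFun (congrFun hs i) j
  have e00 := e 0 0
  have e01 := e 0 1
  have e02 := e 0 2
  have e11 := e 1 1
  have e12 := e 1 2
  have e22 := e 2 2
  have n22 := congrFun (congrFun hc 2) 2
  simp [Matrix.mul_apply, Fin.sum_univ_three] at e00 e01 e02 e11 e12 e22 n22
  have f00 := congrArg (starRingEnd ℂ) e00
  have f02 := congrArg (starRingEnd ℂ) e02
  rw [star_def] at hstar
  simp [hstar] at f00 f02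
  have hd' := hd
  rw [Matrix.det_fin_three] at hd'
  -- The entries (0,2) and (1,2) combine to c₀₂ = ε⁻²c₀₂, and ε² ≠ 1. For c₀₁ below, the entries
  -- (0,0) and (1,1) lead to ε⁴ = 1, which is excluded by ε³ = −1 and ε² ≠ 1.
  have g02 : (starRingEnd ℂ) (c 0 2) = 0 := by
    clear f00 e00 e01 e11 e22 n22 hd' e hs hinv hc hd hstar
    generalize (starRingEnd ℂ) (c 0 2) = X at *
    grind
  have g01 : (starRingEnd ℂ) (c 0 1) = 0 := by
    clear f02 e00 e01 e02 e12 e22 n22 hd' e hs hinv hc hd hstar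
    generalize (starRingEnd ℂ) (c 0 1) = X at *
    grind
  have g12 : c 1 2 = 0 := by rw [← e12, g02, mul_zero]
  have g02' : c 0 2 = 0 := by simpa using g02
  have g01' : c 0 1 = 0 := by simpa using g01
  have g00 : c 0 0 = (starRingEnd ℂ) (c 1 1) :=
    (mul_left_cancel₀ (pow_ne_zero 2 h0) (e01.trans (mul_comm _ _))).symm
  rw [g02', g12, e22] at n22
  rw [g02', g12, g01', g00, mul_comm ((starRingEnd ℂ) _), mul_conj] at hd'
  have g22 : c 2 2 = 1 := by
    have h4 : (c 2 2 - 1) * (c 2 2 + 1) = 0 := by linear_combination n22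
    rcases mul_eq_zero.1 h4 with h4 | h4
    · exact sub_eq_zero.1 h4
    -- If c₂₂ = −1, the determinant would be −|c₁₁|², which cannot be 1.
    · exfalso
      rw [eq_neg_of_add_eq_zero_left h4] at hd'
      have h5 := congrArg Complex.re hd'
      simp at h5
      linarith [normSq_nonneg (c 1 1)]
  fin_cases i
  · simpa using g02'
  · simpa using g12
  · exact g22

end Twist

/-- The continuous real-linear map taking a matrix to its third column. -/
noncomputable def col3 : M3 →L[ℝ] C3 :=
  LinearMap.toContinuousLinearMap
    { toFun := fun A => Matrix.toEuclideanLin A e3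
      map_add' := fun A B => by simp
      map_smul' := fun c A => by
        ext i
        simp [Matrix.toLpLin_apply, Matrix.smul_mulVec] }

theorem col3_apply (A : M3) (i : Fin 3) : col3 A i = A i 2 := by
  change (Matrix.toEuclideanLin A e3) i = _
  simp [e3, Matrix.toLpLin_apply]

theorem inner_col3 (X Y : M3) : inner ℂ (col3 X) (col3 Y) = (Xᴴ * Y) 2 2 := by
  simp [PiLp.inner_apply, col3_apply, Matrix.mul_apply, mul_comm]

theorem toEuclideanLin_col3 (A B : M3) : Matrix.toEuclideanLin A (col3 B) = col3 (A * B) := by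
  change Matrix.toEuclideanLin A (Matrix.toEuclideanLin B e3) = Matrix.toEuclideanLin (A * B) e3
  simp [Matrix.toLpLin_apply]

/-! ### Uniqueness of the third column of the unitary factor -/

section Uniqueness

theorem IsPlusLoop.mul_adjugate {v : ℂ → M3} (hv : IsPlusLoop v) {ζ : ℂ} (hζ : ‖ζ‖ ≤ 1) :
    v ζ * adjugate (v ζ) = 1 := by
  rw [Matrix.mul_adjugate, hv.det_eq_one ζ hζ, one_smul]

theorem differentiableOn_adjugate {X : ℂ → M3} {s : Set ℂ}
    (hX : ∀ i j, DifferentiableOn ℂ (fun ζ => X ζ i j) s) (i j : Fin 3) :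
    DifferentiableOn ℂ (fun ζ => adjugate (X ζ) i j) s := by
  simp only [Matrix.adjugate_fin_three]
  fin_cases i <;> fin_cases j <;> simp <;> fun_prop

/-- The third column of the unitary factor in an Iwasawa decomposition is unique. -/
theorem col3_eq_of_isIwasawa {g h v : ℂ → M3} (hi : IsIwasawa g h v) {G V : ℂ → M3}
    (hV : IsPlusLoop V) (hG : ∀ ζ : ℂ, ‖ζ‖ = 1 → (G ζ)ᴴ * G ζ = 1)
    (hg : ∀ ζ : ℂ, ‖ζ‖ = 1 → g ζ = G ζ * V ζ) {ζ : ℂ} (hζ : ‖ζ‖ = 1) :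
    col3 (h ζ) = col3 (G ζ) := by
  -- The adjugate is the inverse in determinant one, and being polynomial in the entries it visibly
  -- keeps continuity and holomorphy.
  let w : ℂ → M3 := fun ζ => V ζ * adjugate (v ζ)
  have hv := hi.plus
  have hwc : ContinuousOn w (Metric.closedBall 0 1) :=
    hV.continuousOn.mul ((Continuous.matrix_adjugate continuous_id).comp_continuousOn
      hv.continuousOn)
  have hwd : ∀ i j, DifferentiableOn ℂ (fun ζ => w ζ i j) (Metric.ball 0 1) := by
    intro i j
    have h1 := fun k => hV.holomorphic i k
    have h2 := fun k => differentiableOn_adjugate hv.holomorphic k j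
    simp only [w, Matrix.mul_apply]
    exact DifferentiableOn.fun_sum fun k _ => (h1 k).mul (h2 k)
  have hdet : ∀ ζ : ℂ, ‖ζ‖ ≤ 1 → (w ζ).det = 1 := by
    intro ζ hζ
    simp [w, Matrix.det_adjugate, hV.det_eq_one ζ hζ, hv.det_eq_one ζ hζ]
  have hwv : ∀ ζ : ℂ, ‖ζ‖ ≤ 1 → w ζ * v ζ = V ζ := by
    intro ζ hζ
    simp only [w]
    rw [Matrix.mul_assoc, _root_.mul_eq_one_comm.1 (hv.mul_adjugate hζ), Matrix.mul_one]
  have hh : ∀ ζ : ℂ, ‖ζ‖ = 1 → h ζ = G ζ * w ζ := by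
    intro ζ hζ
    have e : G ζ * V ζ = h ζ * v ζ := by rw [← hg ζ hζ, ← hi.mul_eq ζ hζ]
    simp only [w]
    rw [← Matrix.mul_assoc, e, Matrix.mul_assoc, hv.mul_adjugate hζ.le, Matrix.mul_one]
  have hwu : ∀ ζ : ℂ, ‖ζ‖ = 1 → (w ζ)ᴴ * w ζ = 1 := by
    intro ζ hζ
    have h1 : (h ζ)ᴴ * h ζ = 1 :=
      Matrix.mem_unitaryGroup_iff'.1 (Matrix.mem_specialUnitaryGroup_iff.1
        (hi.unitary.mem_SU ζ hζ)).1
    rw [hh ζ hζ, Matrix.conjTranspose_mul, Matrix.mul_assoc, ← Matrix.mul_assoc _ (G ζ),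
      hG ζ hζ, Matrix.one_mul] at h1
    exact h1
  -- On the circle w* = w⁻¹ = adj w, so the conjugate of each entry of w also extends
  -- holomorphically to the disc.
  have hconst : ∀ ζ : ℂ, ‖ζ‖ = 1 → w ζ = w 0 := by
    intro ζ hζ
    ext i j
    refine eq_const_of_conj_on_sphere (f := fun ζ => w ζ i j) (g := fun ζ => adjugate (w ζ) j i)
      ?_ ?_ (hwd i j) (differentiableOn_adjugate hwd j i) ?_ ζ hζ
    · exact (continuous_apply_apply i j).comp_continuousOn hwc
    · exact (continuous_apply_apply j i).comp_continuousOn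
        ((Continuous.matrix_adjugate continuous_id).comp_continuousOn hwc)
    · intro ζ hζ
      have e : adjugate (w ζ) = (w ζ)ᴴ := by
        calc adjugate (w ζ) = (w ζ)ᴴ * w ζ * adjugate (w ζ) := by
              rw [hwu ζ hζ, Matrix.one_mul]
          _ = (w ζ)ᴴ := by
              rw [Matrix.mul_assoc, Matrix.mul_adjugate, hdet ζ hζ.le, one_smul, Matrix.mul_one]
      simp only [e]
      rfl
  -- The twisting of V = wv and of v gives σ(w(ζ)) = w(εζ), and w is constant on the circle.
  have hfix : sigma (w ζ) = w ζ := by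
    have hε : ‖exp (Real.pi * I / 3) * ζ‖ = 1 := by rw [norm_mul, norm_epsilon, hζ, one_mul]
    have e := hV.twisted ζ hζ
    rw [← hwv ζ hζ.le, ← hwv _ hε.le, sigma_mul, hv.twisted ζ hζ, hconst _ hε,
      ← hconst _ hζ] at e
    have e2 := congrArg (· * adjugate (v (exp (Real.pi * I / 3) * ζ))) e
    simpa only [Matrix.mul_assoc, hv.mul_adjugate hε.le, Matrix.mul_one] using e2
  have hcol := column_of_sigma_fixed (hwu ζ hζ) (hdet ζ hζ.le) hfix
  rw [hh ζ hζ]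
  ext i
  rw [col3_apply, col3_apply, Matrix.mul_apply]
  simp only [hcol]
  rw [← Matrix.mul_apply, Matrix.mul_one]

end Uniqueness

end MinLag

namespace MinLag

open Complex Matrix

attribute [local instance] Matrix.linftyOpNormedRing Matrix.linftyOpNormedAlgebra

variable {a b : ℂ} {u : ℝ → ℝ} {T : ℝ → ℂ → M3}

/-! ### The explicit Iwasawa decomposition -/

section PlusFactor

/-- The inverse of the diagonal matrix `Q₀`. -/
noncomputable def Q0inv (a : ℂ) (u : ℝ → ℝ) (y : ℝ) : M3 :=
  diagonal ![-I * a * Real.exp (-u y / 2), I * a⁻¹ * Real.exp (u y / 2), 1]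

theorem exp_half_mul_exp_neg_half (y : ℝ) :
    (Real.exp (u y / 2) : ℂ) * Real.exp (-u y / 2) = 1 := by
  rw [← ofReal_mul, ← Real.exp_add]; simp [neg_div]

theorem Q0_mul_Q0inv (ha : a ≠ 0) (y : ℝ) : Q0 a u y * Q0inv a u y = 1 := by
  have h := exp_half_mul_exp_neg_half (u := u) y
  have hI := I_sq
  rw [Q0, Q0inv, Matrix.diagonal_mul_diagonal, ← Matrix.diagonal_one]
  congr 1
  ext i
  generalize (Real.exp (u y / 2) : ℂ) = E at h ⊢
  generalize (Real.exp (-u y / 2) : ℂ) = F at h ⊢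
  fin_cases i <;> simp <;> grind

theorem Q0inv_mul_Q0 (ha : a ≠ 0) (y : ℝ) : Q0inv a u y * Q0 a u y = 1 :=
  _root_.mul_eq_one_comm.1 (Q0_mul_Q0inv ha y)

theorem det_Q0 (ha : a ≠ 0) (y : ℝ) : (Q0 a u y).det = 1 := by
  have h := exp_half_mul_exp_neg_half (u := u) y
  have hI := I_sq
  rw [Q0, Matrix.det_diagonal, Fin.prod_univ_three]
  generalize (Real.exp (u y / 2) : ℂ) = E at h ⊢
  generalize (Real.exp (-u y / 2) : ℂ) = F at h ⊢
  simp
  grind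

/-- Combined with R*R = `metricDiag`, this makes R Q₀⁻¹ unitary. -/
theorem Q0_star_mul (ha : a ≠ 0) (y : ℝ) : (Q0inv a u y)ᴴ * metricDiag a u y * Q0inv a u y = 1 := by
  have h := exp_half_mul_exp_neg_half (u := u) y
  have hE : (Real.exp (u y) : ℂ) = Real.exp (u y / 2) ^ 2 := by
    rw [← ofReal_pow, ← Real.exp_nat_mul]; congr 2; push_cast; ring
  have ha' : (starRingEnd ℂ) a ≠ 0 := by simpa using ha
  have hI := I_sq
  have h1 : star (Real.exp (u y / 2) : ℂ) = Real.exp (u y / 2) := conj_ofReal _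
  have h2 : star (Real.exp (-u y / 2) : ℂ) = Real.exp (-u y / 2) := conj_ofReal _
  rw [Q0inv, metricDiag, hE, Matrix.diagonal_conjTranspose, Matrix.diagonal_mul_diagonal,
    Matrix.diagonal_mul_diagonal, ← Matrix.diagonal_one]
  congr 1
  ext i
  generalize (Real.exp (u y / 2) : ℂ) = E at h h1 ⊢
  generalize (Real.exp (-u y / 2) : ℂ) = F at h h2 ⊢
  rw [star_def] at h1 h2
  fin_cases i <;> simp [h1, h2] <;> generalize (starRingEnd ℂ) a = a' at ha' ⊢ <;> grind

/-- Inversion exchanges the first two diagonal entries of Q₀, whose product is 1, and conjugation by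
P exchanges them back. -/
theorem sigma_Q0 (ha : a ≠ 0) (y : ℝ) : sigma (Q0 a u y) = Q0 a u y := by
  have hinv : ((Q0 a u y)ᵀ)⁻¹ = Q0inv a u y := by
    rw [Q0, Matrix.diagonal_transpose]
    exact Matrix.inv_eq_left_inv (Q0inv_mul_Q0 ha y)
  rw [sigma_eq_iff, hinv]
  ext i j
  fin_cases i <;> fin_cases j <;> simp [Q0, Q0inv, twistP] <;> ring

/-- The infinitesimal twisting condition −P Bᵗ P⁻¹ = εB. -/
theorem twistP_mul_laxB_transpose (y : ℝ) :
    twistP * (laxB a b u y)ᵀ = -(exp (Real.pi * I / 3) • (laxB a b u y * twistP)) := by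
  have h3 := epsilon_pow_three
  simp only [twistP, alpha_eq, laxB]
  generalize exp (Real.pi * I / 3) = ε at *
  ext i j
  simp only [Matrix.mul_apply, Matrix.neg_apply, Matrix.smul_apply, Matrix.transpose_apply,
    Fin.sum_univ_three]
  fin_cases i <;> fin_cases j <;> simp <;> grind

/-- σ(T(y, ζ)) and T(y, εζ) solve the same linear equation, with parameter εζ, and agree at y = 0.
-/
theorem IsPlusFlow.isTwisted (hT : IsPlusFlow a b u T) (y : ℝ) : IsTwisted (T y) := by
  intro ζ _
  have h := hT.eq_of_hasDerivAt (X := fun y => sigma (T y ζ)) (ζ := exp (Real.pi * I / 3) * ζ)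
    (fun y => ?_) y
  · simpa [hT.zero, sigma, Matrix.mul_nonsing_inv _ isUnit_det_twistP] using h
  · have e : (fun y => sigma (T y ζ)) = fun y => twistP * ((T y ζ)⁻¹)ᵀ * twistP⁻¹ :=
      funext fun y => by rw [sigma, Matrix.transpose_nonsing_inv]
    have h1 : HasDerivAt (fun s => ((T s ζ)⁻¹)ᵀ) (-(ζ • ((T y ζ)⁻¹ * laxB a b u y)))ᵀ y := by
      have := hT.hasDerivAt_inv y ζ
      rw [hasDerivAt_matrix_iff] at this ⊢
      exact fun i j => this j i
    rw [e]
    refine ((h1.const_mul twistP).mul_const twistP⁻¹).congr_deriv ?_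
    rw [show sigma (T y ζ) = _ from congrFun e y, Matrix.transpose_neg, Matrix.transpose_smul, Matrix.transpose_mul, mul_neg, mul_smul_comm,
      ← Matrix.mul_assoc, twistP_mul_laxB_transpose]
    simp only [neg_mul, smul_neg, neg_neg, smul_mul_assoc, smul_smul, Matrix.mul_assoc, mul_comm]

theorem IsPlusFlow.isPlusLoop (hT : IsPlusFlow a b u T) (ha : a ≠ 0) (y : ℝ) :
    IsPlusLoop fun ζ => Q0 a u y * T y ζ where
  continuousOn := by
    refine continuousOn_const.mul (Continuous.continuousOn ?_)
    exact continuous_matrix fun i j => (hT.entire y i j).continuous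
  holomorphic i j := by
    simp only [Matrix.mul_apply]
    exact DifferentiableOn.fun_sum fun k _ =>
      ((hT.entire y k j).const_mul _).differentiableOn
  det_eq_one ζ _ := by rw [Matrix.det_mul, det_Q0 ha, hT.det_eq_one, one_mul]
  twisted ζ hζ := by rw [sigma_mul, sigma_Q0 ha, hT.isTwisted y ζ hζ]

/-- Every extended frame has the third column of the frame built from the plus flow. -/
theorem IsPlusFlow.thirdColumn_eq (hT : IsPlusFlow a b u T) (ha : a ≠ 0)
    (hu : IsMetricExponent a b u) {𝔽 : ℂ → ℂ → M3} (hF : IsExtendedFrame (potential a b) 𝔽)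
    {ζ : ℂ} (hζ : ‖ζ‖ = 1) :
    thirdColumn 𝔽 ζ = fun z => col3 (frameR a b T ζ z) := by
  ext1 z
  obtain ⟨v, hv⟩ := hF z
  have h := col3_eq_of_isIwasawa hv (hT.isPlusLoop ha z.im)
    (G := fun ζ => frameR a b T ζ z * Q0inv a u z.im) (fun ζ hζ => ?_) (fun ζ hζ => ?_) hζ
  · refine h.trans ?_
    ext i
    simp [col3_apply, Q0inv]
  · rw [Matrix.conjTranspose_mul, Matrix.mul_assoc, ← Matrix.mul_assoc _ (frameR a b T ζ z),
      hT.conj_frameR ha hu hζ, ← Matrix.mul_assoc, Q0_star_mul ha]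
  · simp only [frameR]
    rw [Matrix.mul_assoc, ← Matrix.mul_assoc (Q0inv a u z.im), Q0inv_mul_Q0 ha, Matrix.one_mul,
      Matrix.mul_assoc, hT.inv_mul, Matrix.mul_one]

end PlusFactor

/-! ### Derivatives and inner products of the third column -/

section Geometry

theorem contDiff_matrix {X : ℝ → M3} (h : ∀ i j, ContDiff ℝ (⊤ : ℕ∞) fun y => X y i j) :
    ContDiff ℝ (⊤ : ℕ∞) X := by
  have e : X = fun y => ∑ i, ∑ j, X y i j • (Matrix.single i j 1 : M3) := by
    funext y
    conv_lhs => rw [Matrix.matrix_eq_sum_single (X y)]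
    simp [Matrix.smul_single]
  rw [e]
  exact ContDiff.sum fun i _ => ContDiff.sum fun j _ => (h i j).smul contDiff_const

theorem contDiff_laxN (hu : IsMetricExponent a b u) (ζ : ℂ) :
    ContDiff ℝ (⊤ : ℕ∞) fun y => laxN a b u y ζ := by
  have h1 : ContDiff ℝ (⊤ : ℕ∞) fun y => (Real.exp (u y) : ℂ) :=
    ofRealCLM.contDiff.comp hu.smooth.exp
  have h2 : ContDiff ℝ (⊤ : ℕ∞) fun y => (Real.exp (u y) : ℂ)⁻¹ :=
    h1.inv fun y => by exact_mod_cast (Real.exp_pos _).ne'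
  have h3 : ContDiff ℝ (⊤ : ℕ∞) fun y => ((deriv u y : ℝ) : ℂ) :=
    ofRealCLM.contDiff.comp hu.contDiff_deriv
  refine contDiff_matrix fun i j => ?_
  simp only [laxN]
  fin_cases i <;> fin_cases j
  · exact (contDiff_const.mul h3).div_const 2
  · exact contDiff_const.mul (h2.pow 2)
  · exact contDiff_const
  · exact contDiff_const
  · exact (contDiff_const.mul h3).div_const 2
  · exact (contDiff_const.mul h1).mul contDiff_const
  · exact (contDiff_const.mul h1).mul contDiff_const
  · exact contDiff_const
  · exact contDiff_const

theorem contDiff_laxK (hu : IsMetricExponent a b u) (ζ : ℂ) :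
    ContDiff ℝ (⊤ : ℕ∞) fun y => laxK a b u y ζ := by
  have h1 : ContDiff ℝ (⊤ : ℕ∞) fun y => (Real.exp (u y) : ℂ) :=
    ofRealCLM.contDiff.comp hu.smooth.exp
  have h2 : ContDiff ℝ (⊤ : ℕ∞) fun y => (Real.exp (u y) : ℂ)⁻¹ :=
    h1.inv fun y => by exact_mod_cast (Real.exp_pos _).ne'
  have h3 : ContDiff ℝ (⊤ : ℕ∞) fun y => ((deriv u y : ℝ) : ℂ) :=
    ofRealCLM.contDiff.comp hu.contDiff_deriv
  refine contDiff_matrix fun i j => ?_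
  simp only [laxK_eq]
  fin_cases i <;> fin_cases j
  · exact h3.div_const 2
  · exact contDiff_const.mul (h2.pow 2)
  · exact contDiff_const
  · exact contDiff_const
  · exact h3.neg.div_const 2
  · exact (contDiff_const.mul h1).mul contDiff_const
  · exact (contDiff_const.mul h1).mul contDiff_const
  · exact contDiff_const
  · exact contDiff_const

theorem hasDerivAt_laxK (ha : a ≠ 0) (hu : IsMetricExponent a b u) (y : ℝ) {ζ : ℂ} (hζ : ζ ≠ 0) :
    HasDerivAt (fun y => laxK a b u y ζ)
      (I • (ζ • (laxB a b u y * laxN a b u y ζ) - ζ • (laxN a b u y ζ * laxB a b u y)) -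
        ζ • laxB' a b u y) y :=
  ((hasDerivAt_laxN ha hu y hζ).const_smul I).sub ((hasDerivAt_laxB hu y).const_smul ζ)

namespace IsPlusFlow

/-- Bootstrapping: dR is R times smooth coefficients, so each order of regularity of R yields the
next. -/
theorem contDiff_frameR (hT : IsPlusFlow a b u T) (ha : a ≠ 0) (hu : IsMetricExponent a b u)
    {ζ : ℂ} (hζ : ζ ≠ 0) : ContDiff ℝ (⊤ : ℕ∞) (frameR a b T ζ) := by
  have hR := hT.hasFDerivAt_frameR ha hu hζ
  refine contDiff_infty.2 fun n => ?_
  induction n with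
  | zero => exact contDiff_zero.2 (continuous_iff_continuousAt.2 fun z => (hR z).continuousAt)
  | succ n ih =>
    refine (contDiff_succ_iff_fderiv (n := (n : WithTop ℕ∞))).2
      ⟨fun z => (hR z).differentiableAt, by simp, ?_⟩
    have hle : ((n : ℕ∞) : WithTop ℕ∞) ≤ ((⊤ : ℕ∞) : WithTop ℕ∞) := by exact_mod_cast le_top
    have h1 := ((contDiff_laxN hu ζ).of_le hle).comp (imCLM.contDiff (n := (n : WithTop ℕ∞)))
    have h2 := ((contDiff_laxK hu ζ).of_le hle).comp (imCLM.contDiff (n := (n : WithTop ℕ∞)))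
    have key := ((contDiff_const (c := reCLM)).smulRight (ih.mul h1)).add
      ((contDiff_const (c := imCLM)).smulRight (ih.mul h2))
    convert key using 1
    exact funext fun z => (hR z).fderiv

/-- The extra factor M covers both orders of differentiation: M = 1 gives the first derivatives of
F, while M = N and M = K give the second. -/
theorem hasFDerivAt_col3_frameR_mul (hT : IsPlusFlow a b u T) (ha : a ≠ 0)
    (hu : IsMetricExponent a b u) {ζ : ℂ} (hζ : ζ ≠ 0) {M : ℝ → M3} {M' : M3} {z : ℂ}
    (hM : HasDerivAt M M' z.im) :
    HasFDerivAt (fun w => col3 (frameR a b T ζ w * M w.im))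
      (reCLM.smulRight (col3 (frameR a b T ζ z * (laxN a b u z.im ζ * M z.im))) +
        imCLM.smulRight (col3 (frameR a b T ζ z * (laxK a b u z.im ζ * M z.im + M')))) z := by
  have h1 := hT.hasFDerivAt_frameR ha hu hζ z
  have h2 := hM.hasFDerivAt.comp z (imCLM.hasFDerivAt (x := z))
  refine ((col3.hasFDerivAt).comp z (h1.mul' h2)).congr_fderiv ?_
  ext1 v
  change col3 (frameR a b T ζ z * (v.im • M') + (v.re • (frameR a b T ζ z * laxN a b u z.im ζ) +
    v.im • (frameR a b T ζ z * laxK a b u z.im ζ)) * M z.im) = v.re • col3 _ + v.im • col3 _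
  rw [← map_smul, ← map_smul, ← map_add]
  congr 1
  rw [add_mul, smul_mul_assoc, smul_mul_assoc, mul_smul_comm, Matrix.mul_add, smul_add,
    Matrix.mul_assoc, Matrix.mul_assoc]
  abel

theorem fderiv_col3_frameR (hT : IsPlusFlow a b u T) (ha : a ≠ 0)
    (hu : IsMetricExponent a b u) {ζ : ℂ} (hζ : ζ ≠ 0) (z v : ℂ) :
    fderiv ℝ (fun w => col3 (frameR a b T ζ w)) z v =
      col3 (frameR a b T ζ z * ((v.re : ℂ) • laxN a b u z.im ζ + (v.im : ℂ) • laxK a b u z.im ζ)) := by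
  have h := hT.hasFDerivAt_col3_frameR_mul ha hu hζ (z := z) (hasDerivAt_const z.im (1 : M3))
  simp only [Matrix.mul_one, add_zero] at h
  rw [h.fderiv]
  change v.re • col3 _ + v.im • col3 _ = _
  rw [← map_smul, ← map_smul, ← map_add, Matrix.mul_add, mul_smul_comm, mul_smul_comm]
  rfl

theorem inner_col3_frameR (hT : IsPlusFlow a b u T) (ha : a ≠ 0)
    (hu : IsMetricExponent a b u) {ζ : ℂ} (hζ : ‖ζ‖ = 1) (z : ℂ) (X Y : M3) :
    inner ℂ (col3 (frameR a b T ζ z * X)) (col3 (frameR a b T ζ z * Y)) =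
      (Xᴴ * metricDiag a u z.im * Y) 2 2 := by
  rw [inner_col3, Matrix.conjTranspose_mul, ← hT.conj_frameR ha hu hζ z]
  simp only [Matrix.mul_assoc]

end IsPlusFlow

end Geometry

end MinLag

/-! ### Metric, Lagrangian condition, minimality and equivariance -/

namespace MinLag

open Complex Matrix

attribute [local instance] Matrix.linftyOpNormedRing Matrix.linftyOpNormedAlgebra

variable {a b : ℂ} {u : ℝ → ℝ} {T : ℝ → ℂ → M3}

/-- In the metric R*R the third columns of N and K are orthogonal with squared length 2e^u. The
vanishing complex product gives conformality and the Lagrangian condition together. -/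
theorem lax_hermitian (ha : a ≠ 0) {ζ : ℂ} (hζ : ‖ζ‖ = 1) (y : ℝ) (s t s' t' : ℝ) :
    (((s : ℂ) • laxN a b u y ζ + (t : ℂ) • laxK a b u y ζ)ᴴ * metricDiag a u y *
      ((s' : ℂ) • laxN a b u y ζ + (t' : ℂ) • laxK a b u y ζ)) 2 2 =
    (2 * Real.exp (u y) * (s * s' + t * t') : ℝ) := by
  have hE : (Real.exp (u y) : ℂ) ≠ 0 := by exact_mod_cast (Real.exp_pos _).ne'
  have hE' : star (Real.exp (u y) : ℂ) = Real.exp (u y) := conj_ofReal _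
  have ha' : star a ≠ 0 := by simpa using ha
  have hz := star_inv_of_norm_eq_one hζ
  have hz0 : ζ ≠ 0 := by rintro rfl; simp at hζ
  have hI := I_sq
  rw [metricDiag, Matrix.mul_apply, Fin.sum_univ_three, laxK_eq, laxN]
  simp only [Matrix.mul_diagonal, Matrix.conjTranspose_apply, Matrix.add_apply, Matrix.smul_apply]
  push_cast only [ofReal_mul, ofReal_add]
  generalize (Real.exp (u y) : ℂ) = E at hE hE' ⊢
  simp only [star_def] at *
  simp [hE', hz]
  generalize (starRingEnd ℂ) a = a' at ha' ⊢
  grind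

theorem metricDiag_apply_two_two (y : ℝ) : metricDiag a u y 2 2 = 1 := by
  simp [metricDiag]

theorem norm_sq_of_inner_self {x : C3} {r : ℝ} (h : inner ℂ x x = (r : ℂ)) : ‖x‖ ^ 2 = r := by
  rw [← inner_self_eq_norm_sq (𝕜 := ℂ), h]
  exact ofReal_re r

namespace IsPlusFlow

theorem inner_fderiv (hT : IsPlusFlow a b u T) (ha : a ≠ 0) (hu : IsMetricExponent a b u) {ζ : ℂ}
    (hζ : ‖ζ‖ = 1) (z v w : ℂ) :
    inner ℂ (fderiv ℝ (fun w => col3 (frameR a b T ζ w)) z v)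
      (fderiv ℝ (fun w => col3 (frameR a b T ζ w)) z w) =
      (2 * Real.exp (u z.im) * (v.re * w.re + v.im * w.im) : ℝ) := by
  have hζ0 : ζ ≠ 0 := by rintro rfl; simp at hζ
  rw [hT.fderiv_col3_frameR ha hu hζ0, hT.fderiv_col3_frameR ha hu hζ0,
    hT.inner_col3_frameR ha hu hζ, lax_hermitian ha hζ]

theorem isHorizontalLift (hT : IsPlusFlow a b u T) (ha : a ≠ 0) (hu : IsMetricExponent a b u)
    {ζ : ℂ} (hζ : ‖ζ‖ = 1) {f : ℂ → CP2} (hf : IsLift f fun z => col3 (frameR a b T ζ z)) :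
    IsHorizontalLift f fun z => col3 (frameR a b T ζ z) where
  lift := hf
  smooth := by
    have hζ0 : ζ ≠ 0 := by rintro rfl; simp at hζ
    exact col3.contDiff.comp (hT.contDiff_frameR ha hu hζ0)
  norm_eq_one z := by
    have h := hT.inner_col3_frameR ha hu hζ z 1 1
    simp only [Matrix.mul_one, Matrix.conjTranspose_one, Matrix.one_mul,
      metricDiag_apply_two_two] at h
    have h2 : ‖col3 (frameR a b T ζ z)‖ ^ 2 = 1 := norm_sq_of_inner_self (by simpa using h)
    exact (pow_eq_one_iff_of_nonneg (norm_nonneg _) two_ne_zero).1 h2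
  horizontal z v := by
    have hζ0 : ζ ≠ 0 := by rintro rfl; simp at hζ
    have h := hT.inner_col3_frameR ha hu hζ z 1
      ((v.re : ℂ) • laxN a b u z.im ζ + (v.im : ℂ) • laxK a b u z.im ζ)
    rw [hT.fderiv_col3_frameR ha hu hζ0]
    rw [Matrix.mul_one] at h
    rw [h, Matrix.conjTranspose_one, Matrix.one_mul, metricDiag, Matrix.diagonal_mul, laxK_eq, laxN]
    simp

theorem isConformalMinimalLagrangianLift (hT : IsPlusFlow a b u T) (ha : a ≠ 0)
    (hu : IsMetricExponent a b u) {ζ : ℂ} (hζ : ‖ζ‖ = 1) :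
    IsConformalMinimalLagrangianLift (fun z => col3 (frameR a b T ζ z)) fun z => u z.im where
  norm_sq_dx z := by
    rw [norm_sq_of_inner_self (hT.inner_fderiv ha hu hζ z 1 1)]
    simp
  norm_sq_dy z := by
    rw [norm_sq_of_inner_self (hT.inner_fderiv ha hu hζ z I I)]
    simp
  inner_dx_dy z := by
    rw [hT.inner_fderiv ha hu hζ z 1 I]
    simp
  minimal z := by
    have hζ0 : ζ ≠ 0 := by rintro rfl; simp at hζ
    have hF : ContDiff ℝ (⊤ : ℕ∞) fun z => col3 (frameR a b T ζ z) :=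
      col3.contDiff.comp (hT.contDiff_frameR ha hu hζ0)
    have hdF : DifferentiableAt ℝ (fderiv ℝ fun z => col3 (frameR a b T ζ z)) z :=
      (contDiff_infty_iff_fderiv.1 hF).2.differentiable (by simp) z
    have hsnd : ∀ v : ℂ, fderiv ℝ (fderiv ℝ fun z => col3 (frameR a b T ζ z)) z v v =
        fderiv ℝ (fun w => fderiv ℝ (fun z => col3 (frameR a b T ζ z)) w v) z v := by
      intro v
      rw [fderiv_clm_apply hdF (differentiableAt_const v)]
      simp
    rw [InnerProductSpace.laplacian_eq_iteratedFDeriv_complexPlane]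
    simp only [iteratedFDeriv_two_apply, Matrix.cons_val_zero, Matrix.cons_val_one]
    rw [hsnd, hsnd]
    simp only [hT.fderiv_col3_frameR ha hu hζ0]
    simp only [one_re, one_im, I_re, I_im, ofReal_one, ofReal_zero, one_smul, zero_smul, add_zero,
      zero_add]
    rw [(hT.hasFDerivAt_col3_frameR_mul ha hu hζ0 (hasDerivAt_laxN ha hu z.im hζ0)).fderiv,
      (hT.hasFDerivAt_col3_frameR_mul ha hu hζ0 (hasDerivAt_laxK ha hu z.im hζ0)).fderiv]
    change ((1 : ℂ).re • col3 _ + (1 : ℂ).im • col3 _) + (I.re • col3 _ + I.im • col3 _) = _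
    simp only [one_re, one_im, I_re, I_im, one_smul, zero_smul, add_zero, zero_add]
    -- F_xx + F_yy is the third column of R(N² + K² + K').
    rw [← map_add, ← Matrix.mul_add, ← add_assoc]
    have hl := fun i => lax_laplacian (a := a) (b := b) (u := u) ha (y := z.im) hζ0 i
    ext i
    rw [col3_apply, Matrix.mul_apply]
    simp only [hl, Fin.sum_univ_three]
    simp [col3_apply]
    ring

end IsPlusFlow

theorem col3_frameR_add (ζ : ℂ) (t : ℝ) (z : ℂ) : col3 (frameR a b T ζ (z + t)) =
    Matrix.toEuclideanLin (NormedSpace.exp ((t : ℂ) • potential a b ζ))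
      (col3 (frameR a b T ζ z)) := by
  rw [toEuclideanLin_col3]
  congr 1
  simp only [frameR]
  rw [← Matrix.mul_assoc, ← Matrix.exp_add_of_commute, ← add_smul, add_comm z]
  · simp
  · exact ((Commute.refl _).smul_left _).smul_right _

end MinLag

/-! ### The differential equation of the explicit matrix Q̃ -/

namespace MinLag

open Complex Matrix

attribute [local instance] Matrix.linftyOpNormedRing Matrix.linftyOpNormedAlgebra

variable {a b : ℂ} {u : ℝ → ℝ} {T : ℝ → ℂ → M3}

/-- The derivative of `cCheck` in `y`. -/
noncomputable def cCheck' (a b : ℂ) (u : ℝ → ℝ) (y : ℝ) : ℂ :=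
  -(Real.exp (u y) * ((deriv u y : ℝ) : ℂ) ^ 2 + Real.exp (u y) * (-4 * Real.exp (u y) +
    4 * (psi a b * star (psi a b)) * (Real.exp (u y) : ℂ)⁻¹ ^ 2))

theorem hasDerivAt_exp_mul_deriv (hu : IsMetricExponent a b u) (y : ℝ) :
    HasDerivAt (fun y => (Real.exp (u y) : ℂ) * ((deriv u y : ℝ) : ℂ)) (-cCheck' a b u y) y := by
  refine ((hasDerivAt_exp_metric hu y).fun_mul (hasDerivAt_deriv_metric hu y)).congr_deriv ?_
  rw [cCheck']
  ring

theorem hasDerivAt_cCheck (hu : IsMetricExponent a b u) (y : ℝ) (ζ : ℂ) :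
    HasDerivAt (fun y => cCheck a b u y ζ) (cCheck' a b u y) y := by
  have h := (hasDerivAt_exp_mul_deriv hu y).const_sub (delta a b ζ)
  simp only [cCheck, ofReal_mul]
  exact h.congr_deriv (neg_neg _)

/-- The derivative of `QtildeCore` in `y`. -/
noncomputable def QtildeCore' (a b : ℂ) (u : ℝ → ℝ) (y : ℝ) (ζ : ℂ) : M3 :=
  let A : ℂ := a * star a
  let E : ℂ := Real.exp (u y)
  let p : ℂ := (deriv u y : ℝ)
  let p' : ℂ := -4 * E + 4 * (psi a b * star (psi a b)) * E⁻¹ ^ 2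
  !![-A * p' / 2 - ζ ^ 3 * star (psi a b) * A * E⁻¹ * p,
     ζ⁻¹ ^ 2 * a / star a * (p' / 2 * A + ζ ^ 3 * star (psi a b) * A * E⁻¹ * p),
     2 * I * ζ⁻¹ * a * E * p;
     ζ ^ 2 / a ^ 2 * (A / 2 * (p' * E + E * p ^ 2) - ζ⁻¹ ^ 3 * psi a b * E * p),
     1 / A * (-A / 2 * (p' * E + E * p ^ 2) + ζ ^ 3 * star (psi a b) * E * p),
     -2 * I * ζ * a⁻¹ * (E * p * A - 2 * E ^ 2 * p);
     0, 0, cCheck' a b u y]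

theorem ofReal_norm_sq (a : ℂ) : ((‖a‖ ^ 2 : ℝ) : ℂ) = a * star a := by
  rw [star_def, mul_conj, normSq_eq_norm_sq]

theorem hasDerivAt_QtildeCore (hu : IsMetricExponent a b u) (y : ℝ) (ζ : ℂ) :
    HasDerivAt (fun y => QtildeCore a b u y ζ) (QtildeCore' a b u y ζ) y := by
  have hE0 : (Real.exp (u y) : ℂ) ≠ 0 := by exact_mod_cast (Real.exp_pos _).ne'
  have hE := hasDerivAt_exp_metric hu y
  have hF := hasDerivAt_exp_metric_inv hu y
  have hp := hasDerivAt_deriv_metric hu y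
  have hc := hasDerivAt_cCheck hu y ζ
  rw [hasDerivAt_matrix_iff]
  intro i j
  simp only [QtildeCore, QtildeCore', ofReal_norm_sq]
  fin_cases i <;> fin_cases j
  · refine ((((hp.div_const 2).const_mul (-(a * star a))).add
      (hF.const_mul (ζ ^ 3 * star (psi a b) * (a * star a)))).sub_const
      (ζ⁻¹ ^ 3 * psi a b)).congr_deriv ?_
    simp [-mul_eq_mul_left_iff]
    ring
  · refine ((((hp.div_const 2).mul_const (a * star a)).sub
      ((hF.const_mul (ζ ^ 3 * star (psi a b))).mul (hE.const_sub (a * star a)))).const_mul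
      (ζ⁻¹ ^ 2 * a / star a)).congr_deriv ?_
    generalize (Real.exp (u y) : ℂ) = E at hE0 ⊢
    simp [-mul_eq_mul_left_iff]
    field_simp
    ring
  · refine ((hE.const_sub (a * star a)).const_mul (-2 * I * ζ⁻¹ * a)).congr_deriv ?_
    simp [-mul_eq_mul_left_iff]
    ring
  · refine (((((hp.div_const 2).const_mul (a * star a)).mul hE).add
      ((hE.const_sub (a * star a)).const_mul (ζ⁻¹ ^ 3 * psi a b))).const_mul
      (ζ ^ 2 / a ^ 2)).congr_deriv ?_
    simp [-mul_eq_mul_left_iff]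
    ring
  · refine (((((hp.div_const 2).const_mul (-(a * star a))).mul hE).add
      (hE.const_mul (ζ ^ 3 * star (psi a b))) |>.sub_const
      (ζ⁻¹ ^ 3 * psi a b * (a * star a))).const_mul (1 / (a * star a))).congr_deriv ?_
    simp [-mul_eq_mul_left_iff]
    ring
  · refine ((hE.const_mul (-2 * I * ζ * a⁻¹)).mul (hE.const_sub (a * star a))).congr_deriv ?_
    simp [-mul_eq_mul_left_iff]
    ring
  · exact hasDerivAt_const y (0 : ℂ)
  · exact hasDerivAt_const y (0 : ℂ)
  · exact hc

theorem sq_deriv_metric (ha : a ≠ 0) (hu : IsMetricExponent a b u) (y : ℝ) :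
    ((deriv u y : ℝ) : ℂ) ^ 2 = 8 * (a * star a + b * star b / 2 - Real.exp (u y)
      - psi a b * star (psi a b) / 2 * (Real.exp (u y) : ℂ)⁻¹ ^ 2) := by
  have h := hu.first_integral ha y
  have h2 : (Real.exp (-2 * u y)) = (Real.exp (u y))⁻¹ ^ 2 := by
    rw [← Real.exp_neg, ← Real.exp_nat_mul]; congr 1; push_cast; ring
  rw [← ofReal_norm_sq, ← ofReal_norm_sq, ← ofReal_norm_sq, ← ofReal_pow, h, h2]
  push_cast
  ring

/-- One third of the trace of `D²`. -/
noncomputable def traceThird (a b : ℂ) : ℂ := -(4 * (a * star a) + 2 * (b * star b)) / 3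

/-- This is the equation T' = ζBT for s·C·exp(β₁D) exp(β₂(D² − κ)), with C = `QtildeCore` and s its
scalar factor, multiplied by č/s and stripped of the exponentials. The term −(2/3)č' is č s'/s.
Entrywise it is a rational identity modulo the first integral; the second-order equation is already
built into `QtildeCore'`. -/
theorem QtildeCore_ode (ha : a ≠ 0) (hu : IsMetricExponent a b u) (y : ℝ) {ζ : ℂ} (hζ : ζ ≠ 0) :
    (-(2 / 3) * cCheck' a b u y) • QtildeCore a b u y ζ +
      cCheck a b u y ζ • QtildeCore' a b u y ζ +
      QtildeCore a b u y ζ *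
        ((2 * I * ζ ^ 3 * star (psi a b) - I * (deriv u y * Real.exp (u y) : ℝ)) • potential a b ζ +
          (2 * Real.exp (u y) : ℂ) • (potential a b ζ * potential a b ζ - traceThird a b • 1)) =
      (cCheck a b u y ζ * ζ) • (laxB a b u y * QtildeCore a b u y ζ) := by
  have hE : (Real.exp (u y) : ℂ) ≠ 0 := by exact_mod_cast (Real.exp_pos _).ne'
  have hp := sq_deriv_metric ha hu y
  have ha' : star a ≠ 0 := by simpa using ha
  have hψ : psi a b = -I * a ^ 2 * b := rfl
  have hψ' : star (psi a b) = I * star a ^ 2 * star b := by simp [psi]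
  have hI := I_sq
  have hN : (potential a b ζ * potential a b ζ - traceThird a b • (1 : M3)) =
      !![(a * star a - b * star b) / 3, ζ⁻¹ ^ 2 * a ^ 2, ζ ^ 2 * star a * star b;
         ζ ^ 2 * star a ^ 2, (a * star a - b * star b) / 3, ζ⁻¹ ^ 2 * a * b;
         ζ⁻¹ ^ 2 * a * b, ζ ^ 2 * star a * star b, 2 * (b * star b - a * star a) / 3] := by
    simp only [potential, traceThird]
    generalize star a = a'
    generalize star b = b'
    ext i j
    fin_cases i <;> fin_cases j <;> simp <;> field_simp <;> ring
  have hEi : (Real.exp (u y) : ℂ) * (Real.exp (u y) : ℂ)⁻¹ = 1 := mul_inv_cancel₀ hE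
  have hzi : ζ * ζ⁻¹ = 1 := mul_inv_cancel₀ hζ
  rw [hN]
  ext i j
  simp only [Matrix.add_apply, Matrix.smul_apply, Matrix.mul_apply, Fin.sum_univ_three]
  simp only [QtildeCore, QtildeCore', cCheck, cCheck', delta, ofReal_norm_sq, potential, laxB,
    ofReal_mul, hψ'] at hp ⊢
  rw [hψ] at hp ⊢
  generalize (Real.exp (u y) : ℂ) = E at *
  generalize ((deriv u y : ℝ) : ℂ) = p at *
  generalize star a = a' at *
  generalize star b = b' at *
  clear hψ hψ' hN
  fin_cases i <;> fin_cases j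
  all_goals
    clear hEi hzi
    simp
    field_simp at hp ⊢
    grind

end MinLag

namespace MinLag

open Complex Matrix

attribute [local instance] Matrix.linftyOpNormedRing Matrix.linftyOpNormedAlgebra

variable {a b : ℂ} {u : ℝ → ℝ} {T : ℝ → ℂ → M3}

/-! ### Exponentials on eigenvectors -/

section Eigen

/-- The matrix X with all columns equal to l intertwines the scalar μ with A, and intertwining
passes to exponentials. -/
theorem toEuclideanLin_exp_of_eigen {A : M3} {l : C3} {μ : ℂ}
    (h : Matrix.toEuclideanLin A l = μ • l) :
    Matrix.toEuclideanLin (NormedSpace.exp A) l = Complex.exp μ • l := by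
  let X : M3 := Matrix.of fun i _ => l i
  have hmul : ∀ M : M3, ∀ i j, (M * X) i j = (Matrix.toEuclideanLin M l) i := by
    intro M i j
    simp [X, Matrix.mul_apply, Matrix.toLpLin_apply, Matrix.mulVec, dotProduct]
  have hs : SemiconjBy X (algebraMap ℂ M3 μ) A := by
    change X * algebraMap ℂ M3 μ = A * X
    ext i j
    rw [hmul, h, ← Algebra.commutes, Algebra.algebraMap_eq_smul_one, smul_mul_assoc, one_mul]
    simp [X]
  have hs2 := hs.exp_right
  rw [← NormedSpace.algebraMap_exp_comm, ← Complex.exp_eq_exp_ℂ] at hs2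
  ext i
  have h3 := congrFun (congrFun hs2.eq i) 0
  rw [hmul, ← Algebra.commutes, Algebra.algebraMap_eq_smul_one, smul_mul_assoc, one_mul] at h3
  exact h3.symm.trans (by simp [X])

/-- The trace of D² is computed once in the eigenbasis and once in the standard basis, which
identifies the constant in g_j with `traceThird`. -/
theorem sum_sq_eigenvalues (ζ : ℂ) (hζ : ζ ≠ 0) (l : OrthonormalBasis (Fin 3) ℂ C3)
    (μ : Fin 3 → ℂ) (h : ∀ j, Matrix.toEuclideanLin (potential a b ζ) (l j) = μ j • l j) :
    1 / 3 * ∑ k, μ k ^ 2 = traceThird a b := by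
  let L := Matrix.toEuclideanLin (potential a b ζ * potential a b ζ)
  have h1 : ∑ k, μ k ^ 2 = LinearMap.trace ℂ C3 L := by
    rw [LinearMap.trace_eq_sum_inner L l]
    refine Finset.sum_congr rfl fun k _ => ?_
    have e : L (l k) = μ k ^ 2 • l k := by
      have e1 : L (l k) = Matrix.toEuclideanLin (potential a b ζ)
          (Matrix.toEuclideanLin (potential a b ζ) (l k)) := by
        simp [L, Matrix.toLpLin_apply]
      rw [e1, h, map_smul, h, smul_smul, sq]
    rw [e, inner_smul_right, inner_self_eq_norm_sq_to_K, l.orthonormal.1 k]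
    simp
  have h2 : LinearMap.trace ℂ C3 L = (potential a b ζ * potential a b ζ).trace := by
    rw [LinearMap.trace_eq_sum_inner L (EuclideanSpace.basisFun (Fin 3) ℂ)]
    refine Finset.sum_congr rfl fun k _ => ?_
    simp only [L, Matrix.toLpLin_apply, EuclideanSpace.basisFun_apply,
      EuclideanSpace.inner_single_left, map_one, one_mul, PiLp.ofLp_single,
      Matrix.mulVec_single_one, Matrix.col_apply, Matrix.diag_apply]
  rw [h1, h2, Matrix.trace_fin_three, traceThird, potential]
  generalize star a = a'
  generalize star b = b'
  simp
  field_simp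
  ring

end Eigen

/-! ### The closed formula for T and for F -/

section Explicit

variable {ζ : ℂ}

/-- On the circle δ = w̄ − w with w = ζ⁻³ψ, so it is purely imaginary. Since č differs from δ by a
real number, it keeps a fixed nonzero height when w is not real: no zeros, and no crossing of the
branch cut. -/
theorem delta_eq (hζ : ‖ζ‖ = 1) : delta a b ζ = ((-2 * (ζ⁻¹ ^ 3 * psi a b).im : ℝ) : ℂ) * I := by
  have hz := star_inv_of_norm_eq_one hζ
  have h : ζ ^ 3 * star (psi a b) = star (ζ⁻¹ ^ 3 * psi a b) := by
    rw [star_mul, star_pow, ← hz, star_star, mul_comm]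
  rw [delta, h]
  generalize ζ⁻¹ ^ 3 * psi a b = w
  apply Complex.ext <;> simp
  ring

theorem im_cCheck (hζ : ‖ζ‖ = 1) (y : ℝ) :
    (cCheck a b u y ζ).im = -2 * (ζ⁻¹ ^ 3 * psi a b).im := by
  rw [cCheck, delta_eq hζ, sub_im, ofReal_im, sub_zero, mul_I_im, ofReal_re]

theorem cCheck_mem_slitPlane (hζ : ‖ζ‖ = 1) (him : (ζ⁻¹ ^ 3 * psi a b).im ≠ 0) (y : ℝ) :
    cCheck a b u y ζ ∈ slitPlane := by
  refine Complex.mem_slitPlane_iff.2 (Or.inr ?_)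
  rw [im_cCheck hζ]
  exact mul_ne_zero (by norm_num) him

theorem cCheck_ne_zero (hζ : ‖ζ‖ = 1) (him : (ζ⁻¹ ^ 3 * psi a b).im ≠ 0) (y : ℝ) :
    cCheck a b u y ζ ≠ 0 :=
  slitPlane_ne_zero (cCheck_mem_slitPlane hζ him y)

theorem delta_ne_zero (hζ : ‖ζ‖ = 1) (him : (ζ⁻¹ ^ 3 * psi a b).im ≠ 0) : delta a b ζ ≠ 0 := by
  rw [delta_eq hζ]
  refine mul_ne_zero (ofReal_ne_zero.2 (mul_ne_zero (by norm_num) him)) I_ne_zero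

/-- The scalar factor of `Q`. -/
noncomputable def Qscalar (a b : ℂ) (u : ℝ → ℝ) (y : ℝ) (ζ : ℂ) : ℂ :=
  (cCheck a b u y ζ ^ (2 / 3 : ℂ) * delta a b ζ ^ (1 / 3 : ℂ))⁻¹

theorem hasDerivAt_Qscalar (hu : IsMetricExponent a b u) (hζ : ‖ζ‖ = 1)
    (him : (ζ⁻¹ ^ 3 * psi a b).im ≠ 0) (y : ℝ) :
    HasDerivAt (fun y => Qscalar a b u y ζ)
      (-(2 / 3) * (cCheck' a b u y / cCheck a b u y ζ) * Qscalar a b u y ζ) y := by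
  have hc := cCheck_mem_slitPlane (u := u) hζ him y
  have hc0 := slitPlane_ne_zero hc
  have hd := delta_ne_zero hζ him
  have h1 := ((hasDerivAt_id (cCheck a b u y ζ)).cpow_const (c := (2 / 3 : ℂ)) hc).scomp y
    (hasDerivAt_cCheck hu y ζ)
  have hp : cCheck a b u y ζ ^ (2 / 3 : ℂ) ≠ 0 := by simp [cpow_eq_zero_iff, hc0]
  have hq : delta a b ζ ^ (1 / 3 : ℂ) ≠ 0 := by simp [cpow_eq_zero_iff, hd]
  refine ((h1.mul_const (delta a b ζ ^ (1 / 3 : ℂ))).fun_inv (mul_ne_zero hp hq)).congr_deriv ?_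
  simp only [Function.comp, id, Qscalar, cpow_sub _ _ hc0, cpow_one, smul_eq_mul, mul_one]
  field_simp

theorem continuous_cCheck (hu : IsMetricExponent a b u) (ζ : ℂ) :
    Continuous fun y => cCheck a b u y ζ :=
  continuous_iff_continuousAt.2 fun y => (hasDerivAt_cCheck hu y ζ).continuousAt

theorem hasDerivAt_beta1 (hu : IsMetricExponent a b u) (hζ : ‖ζ‖ = 1)
    (him : (ζ⁻¹ ^ 3 * psi a b).im ≠ 0) (y : ℝ) :
    HasDerivAt (fun y => beta1 a b u y ζ)
      ((2 * I * ζ ^ 3 * star (psi a b) - I * (deriv u y * Real.exp (u y) : ℝ)) /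
        cCheck a b u y ζ) y := by
  refine hasDerivAt_integral_of_continuous (h := fun s =>
    (2 * I * ζ ^ 3 * star (psi a b) - I * (deriv u s * Real.exp (u s) : ℝ)) /
        cCheck a b u s ζ) ?_ y
  have h1 := hu.contDiff_deriv.continuous
  have h2 := hu.smooth.continuous
  refine Continuous.div ?_ (continuous_cCheck hu ζ) (cCheck_ne_zero hζ him)
  exact continuous_const.sub (continuous_const.mul
    (continuous_ofReal.comp (h1.mul (Real.continuous_exp.comp h2))))

theorem hasDerivAt_beta2 (hu : IsMetricExponent a b u) (hζ : ‖ζ‖ = 1)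
    (him : (ζ⁻¹ ^ 3 * psi a b).im ≠ 0) (y : ℝ) :
    HasDerivAt (fun y => beta2 a b u y ζ) (2 * Real.exp (u y) / cCheck a b u y ζ) y := by
  refine hasDerivAt_integral_of_continuous (h := fun s =>
    (2 * Real.exp (u s) / cCheck a b u s ζ : ℂ)) ?_ y
  have h2 := hu.smooth.continuous
  refine Continuous.div ?_ (continuous_cCheck hu ζ) (cCheck_ne_zero hζ him)
  exact continuous_const.mul (continuous_ofReal.comp (Real.continuous_exp.comp h2))

/-- The traceless part of `D²`. -/
noncomputable def potentialSq (a b ζ : ℂ) : M3 :=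
  potential a b ζ * potential a b ζ - traceThird a b • 1

theorem commute_potentialSq : Commute (potential a b ζ) (potentialSq a b ζ) :=
  ((Commute.refl _).mul_right (Commute.refl _)).sub_right ((Commute.one_right _).smul_right _)

/-- At y = 0 one has č = δ and the core is δ times the identity. The two principal powers then share
the base δ and multiply to δ without branch ambiguity. -/
theorem Qtilde_zero (ha : a ≠ 0) (hu : IsMetricExponent a b u) (hζ : ‖ζ‖ = 1)
    (him : (ζ⁻¹ ^ 3 * psi a b).im ≠ 0) : Qscalar a b u 0 ζ • QtildeCore a b u 0 ζ = 1 := by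
  have hd := delta_ne_zero hζ him
  have hA : a * star a ≠ 0 := by simp [ha]
  have hEa : (Real.exp (u 0) : ℂ) = a * star a := by rw [hu.exp_zero, ofReal_norm_sq]
  have hc : cCheck a b u 0 ζ = delta a b ζ := by simp [cCheck, hu.deriv_zero]
  have hcore : QtildeCore a b u 0 ζ = delta a b ζ • 1 := by
    simp only [QtildeCore, hc, ofReal_norm_sq, hEa, hu.deriv_zero]
    simp only [delta]
    generalize star (psi a b) = q
    generalize psi a b = r
    generalize a * star a = A at hA ⊢
    ext i j
    fin_cases i <;> fin_cases j <;> simp <;> field_simp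
  rw [hcore, Qscalar, hc, ← cpow_add _ _ hd, show (2 / 3 + 1 / 3 : ℂ) = 1 by norm_num, cpow_one,
    smul_smul, inv_mul_cancel₀ hd, one_smul]

theorem _root_.HasDerivAt.matrix_exp_smul {β : ℝ → ℂ} {β' : ℂ} {y : ℝ} (h : HasDerivAt β β' y)
    (A : M3) : HasDerivAt (fun y => NormedSpace.exp (β y • A))
      (β' • (A * NormedSpace.exp (β y • A))) y := by
  have h1 := (hasDerivAt_exp_smul_const' A (β y)).scomp y h
  exact h1

/-- The product rule for s·C·e₁e₂, kept as pure algebra: the hypothesis is multiplied by s/c and, on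
the right, by e₁e₂. Only K has to be moved past e₁, since D already stands on its left. -/
theorem derivative_of_scaled_ode {s c c' n₁ n₂ : ℂ} {C C' D K L e₁ e₂ : M3} (hc : c ≠ 0)
    (hode : (-(2 / 3) * c') • C + c • C' + C * (n₁ • D + n₂ • K) = (c * ζ) • (L * C))
    (hcomm : e₁ * K = K * e₁) :
    (s • C' + (-(2 / 3) * (c' / c) * s) • C) * (e₁ * e₂) +
      s • C * ((n₁ / c) • (D * e₁) * e₂ + e₁ * ((n₂ / c) • (K * e₂))) =
      ζ • (L * (s • C * (e₁ * e₂))) := by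
  have h := congrArg (fun X => (s / c) • (X * (e₁ * e₂))) hode
  have hcomm' : e₁ * (K * e₂) = K * (e₁ * e₂) := by
    rw [← Matrix.mul_assoc, hcomm, Matrix.mul_assoc]
  simp only [add_mul, mul_add, smul_mul_assoc, mul_smul_comm, Matrix.mul_assoc, hcomm',
    smul_add, smul_smul] at h ⊢
  have e : ζ * s = s / c * (c * ζ) := by field_simp
  rw [e, ← h]
  match_scalars <;> field_simp

/-- The plus flow in terms of `Q̃`. -/
theorem IsPlusFlow.eq_Qtilde (hT : IsPlusFlow a b u T) (ha : a ≠ 0) (hu : IsMetricExponent a b u)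
    (hζ : ‖ζ‖ = 1) (him : (ζ⁻¹ ^ 3 * psi a b).im ≠ 0) (y : ℝ) :
    T y ζ = (Qscalar a b u y ζ • QtildeCore a b u y ζ) *
      (NormedSpace.exp (beta1 a b u y ζ • potential a b ζ) *
        NormedSpace.exp (beta2 a b u y ζ • potentialSq a b ζ)) := by
  have hζ0 : ζ ≠ 0 := by rintro rfl; simp at hζ
  have h := hT.eq_of_hasDerivAt (ζ := ζ)
    (X := fun y => (Qscalar a b u y ζ • QtildeCore a b u y ζ) *
      (NormedSpace.exp (beta1 a b u y ζ • potential a b ζ) *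
        NormedSpace.exp (beta2 a b u y ζ • potentialSq a b ζ))) (fun y => ?_) y
  · rw [Qtilde_zero ha hu hζ him] at h
    simpa [beta1, beta2] using h.symm
  · have hc0 := cCheck_ne_zero (u := u) hζ him y
    have h1 := (hasDerivAt_beta1 hu hζ him y).matrix_exp_smul (potential a b ζ)
    have h2 := (hasDerivAt_beta2 hu hζ him y).matrix_exp_smul (potentialSq a b ζ)
    have h3 := ((hasDerivAt_Qscalar hu hζ him y).fun_smul (hasDerivAt_QtildeCore hu y ζ)).fun_mul
      (h1.fun_mul h2)
    refine h3.congr_deriv ?_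
    have hode := QtildeCore_ode ha hu y hζ0
    have hcomm : NormedSpace.exp (beta1 a b u y ζ • potential a b ζ) * potentialSq a b ζ =
        potentialSq a b ζ * NormedSpace.exp (beta1 a b u y ζ • potential a b ζ) :=
      ((commute_potentialSq (a := a) (b := b) (ζ := ζ)).smul_left _).exp_left
    exact derivative_of_scaled_ode hc0 hode hcomm

theorem IsPlusFlow.col3_frameR_eq_sum (hT : IsPlusFlow a b u T) (ha : a ≠ 0)
    (hu : IsMetricExponent a b u) (hζ : ‖ζ‖ = 1) (him : (ζ⁻¹ ^ 3 * psi a b).im ≠ 0)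
    (l : OrthonormalBasis (Fin 3) ℂ C3) (μ : Fin 3 → ℂ)
    (h : ∀ j, Matrix.toEuclideanLin (potential a b ζ) (l j) = μ j • l j) (z : ℂ) :
    col3 (frameR a b T ζ z) = ∑ j, (Complex.exp (gExp a b u z ζ μ j) *
      inner ℂ (l j) (Matrix.toEuclideanLin (Q a b u z.im ζ)⁻¹ e3)) • l j := by
  have hζ0 : ζ ≠ 0 := by rintro rfl; simp at hζ
  have hκ := sum_sq_eigenvalues ζ hζ0 l μ h
  set w : C3 := Matrix.toEuclideanLin (Q a b u z.im ζ)⁻¹ e3 with hw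
  -- The last diagonal entry of Q₀⁻¹ is 1, so Q⁻¹e₃ = Q̃⁻¹e₃ and the factor Q₀ plays no role.
  have hwc : w = col3 (Qscalar a b u z.im ζ • QtildeCore a b u z.im ζ)⁻¹ := by
    have hQ : Q a b u z.im ζ =
      Q0 a u z.im * (Qscalar a b u z.im ζ • QtildeCore a b u z.im ζ) := rfl
    rw [hw, hQ, Matrix.mul_inv_rev, Matrix.inv_eq_left_inv (Q0inv_mul_Q0 ha z.im)]
    change col3 (_ * _) = _
    ext i
    simp [col3_apply, Q0inv]
  have hsmul : ∀ (c : ℂ) {A : M3} {m : Fin 3 → ℂ},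
      (∀ j, Matrix.toEuclideanLin A (l j) = m j • l j) →
      ∀ j, Matrix.toEuclideanLin (NormedSpace.exp (c • A)) (l j) =
        Complex.exp (c * m j) • l j := fun c A m hA j =>
    toEuclideanLin_exp_of_eigen (by rw [map_smul, LinearMap.smul_apply, hA, smul_smul])
  have hsq : ∀ j, Matrix.toEuclideanLin (potentialSq a b ζ) (l j) =
      (μ j ^ 2 - traceThird a b) • l j := by
    intro j
    have e : Matrix.toEuclideanLin (potential a b ζ * potential a b ζ) (l j) =
        Matrix.toEuclideanLin (potential a b ζ) (Matrix.toEuclideanLin (potential a b ζ) (l j)) := by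
      simp [Matrix.toLpLin_apply]
    rw [potentialSq, map_sub, LinearMap.sub_apply, e, h, map_smul, h, smul_smul, map_smul,
      LinearMap.smul_apply, sub_smul, sq]
    simp
  have hF : col3 (frameR a b T ζ z) =
      Matrix.toEuclideanLin (NormedSpace.exp (z • potential a b ζ))
        (Matrix.toEuclideanLin (NormedSpace.exp (-beta2 a b u z.im ζ • potentialSq a b ζ))
          (Matrix.toEuclideanLin (NormedSpace.exp (-beta1 a b u z.im ζ • potential a b ζ)) w)) := by
    rw [hwc, toEuclideanLin_col3, toEuclideanLin_col3, toEuclideanLin_col3, frameR,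
      hT.eq_Qtilde ha hu hζ him, Matrix.mul_inv_rev, Matrix.mul_inv_rev, neg_smul, neg_smul,
      Matrix.exp_neg, Matrix.exp_neg, Matrix.mul_assoc]
  conv_lhs => rw [hF, ← l.sum_repr' w]
  simp only [map_sum, map_smul, hsmul _ h, hsmul _ hsq, smul_smul]
  refine Finset.sum_congr rfl fun j _ => ?_
  have e : gExp a b u z ζ μ j = -beta1 a b u z.im ζ * μ j +
      -beta2 a b u z.im ζ * (μ j ^ 2 - traceThird a b) + z * μ j := by
    rw [gExp, hκ]
    ring
  rw [e, Complex.exp_add, Complex.exp_add]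
  congr 1
  ring

end Explicit

end MinLag

theorem mainTheorem3 (a b : ℂ) (ha : a ≠ 0) (hb : b ≠ 0)
    (𝔽 : ℂ → ℂ → MinLag.M3) (f : ℂ → ℂ → MinLag.CP2)
    (hf : MinLag.IsGeneratedBy (MinLag.potential a b) 𝔽 f) :
    ∃ u : ℝ → ℝ, MinLag.IsMetricExponent a b u ∧
      ∀ ζ : ℂ, ‖ζ‖ = 1 →
        MinLag.IsHorizontalLift (f ζ) (MinLag.thirdColumn 𝔽 ζ) ∧
        MinLag.IsConformalMinimalLagrangianLift (MinLag.thirdColumn 𝔽 ζ) (fun z => u z.im) ∧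
        (∀ (t : ℝ) (z : ℂ), MinLag.thirdColumn 𝔽 ζ (z + t) =
          Matrix.toEuclideanLin (NormedSpace.exp ((t : ℂ) • MinLag.potential a b ζ))
            (MinLag.thirdColumn 𝔽 ζ z)) ∧
        ((ζ⁻¹ ^ 3 * MinLag.psi a b).im ≠ 0 →
          ∀ (l : OrthonormalBasis (Fin 3) ℂ MinLag.C3) (μ : Fin 3 → ℂ),
            (∀ j, Matrix.toEuclideanLin (MinLag.potential a b ζ) (l j) = μ j • l j) →
            ∀ z : ℂ, MinLag.thirdColumn 𝔽 ζ z =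
              ∑ j, (Complex.exp (MinLag.gExp a b u z ζ μ j) *
                inner ℂ (l j)
                  (Matrix.toEuclideanLin (MinLag.Q a b u z.im ζ)⁻¹ MinLag.e3)) • l j) := by
  obtain ⟨u, hu⟩ := MinLag.exists_isMetricExponent ha hb
  obtain ⟨T, hT⟩ := MinLag.exists_isPlusFlow hu
  refine ⟨u, hu, fun ζ hζ => ?_⟩
  have hl := hf.proj ζ hζ
  -- An extended frame carries no regularity in z; smoothness of F comes entirely from this
  -- identification with the third column of R.
  rw [hT.thirdColumn_eq ha hu hf.frame hζ] at hl ⊢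
  exact ⟨hT.isHorizontalLift ha hu hζ hl, hT.isConformalMinimalLagrangianLift ha hu hζ,
    MinLag.col3_frameR_add ζ, hT.col3_frameR_eq_sum ha hu hζ⟩
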